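/- Let $p\ge 0$, let $1\le l_1\le\dots\le l_p$ be integers, $n=\sum_i l_i$, and write the coordinates of $x\in\mathbb R^n$ as $x_{ij}$, $1\le i\le p$, $1\le j\le l_i$. Let $\underline{x}_j$ be the vector of all coordinates $x_{ik}$ with $1\le i\le p$, $1\le k\le\min(j,l_i)$. Let $U\subset\mathbb R^m$. A system is uniformly observable for any input if in suitable coordinates it has the observable form $$\dot x=\bar A x+\bar f(x,u),\qquad y=\bar C x+\bar h(u),\qquad (1)$$ and we take it in these coordinates. Here $\bar A$ is block diagonal with $l_i\times l_i$ blocks having ones on the first superdiagonal and zeros elsewhere, $\bar C$ is block diagonal with $1\times l_i$ blocks $(1,0,\dots,0)$, and $\bar f(x,u)$ has the components $f_{ij}(\underline{x}_j,u)$. Assume that for $u\in U$ the function $\bar f(\cdot,u)$ is $C^2$ and that there is a constant $L$ with, for all $i,j$, all $u\in U$ and all $x,\xi\in\mathbb R^n$, $$|f_{ij}(\underline{x}_j,u)-f_{ij}(\underline{\xi}_j,u)|\le L\,|\underline{x}_j-\underline{\xi}_j|,\qquad \Big|\sum_{a,b}\frac{\partial^2\bar f}{\partial x_a\partial x_b}(x,u)\,\xi_a\xi_b\Big|\le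 L|\xi|^2,$$ where $a,b$ run over the $n$ coordinates and $|\cdot|$ is the Euclidean norm. Let $G$ be an invertible $n\times n$ matrix and $P^0$ a (symmetric) positive definite $n\times n$ matrix. Then there are $\delta,K,\alpha>0$, depending only on these data, such that the following holds. Let $u:[0,\infty)\to U$ be any input, let $x(t),y(t)$, $t\ge0$, be any state and output trajectories of (1) for $u$, and let $\hat x(t),P(t)$, $t\ge 0$, be a solution of the extended Kalman filter $$\dot{\hat x}=\bar A\hat x+\bar f(\hat x,u)+P\bar C'\big(y-\bar C\hat x-\bar h(u)\big),\qquad \dot P=A(t)P+PA(t)'+GG'-P\bar C'\bar CP,\qquad P(0)=P^0,$$ where $A(t)=\bar A+\frac{\partial\bar f}{\partial x}(\hat x(t),u(t))$. (Differential equations are understood in the sense of Carathéodory, which includes classical solutions for continuous inputs when $\bar f$ is $C^2$ in $(x,u)$.) If $|x(0)-\hat x(0)|<\delta$, then $$|x(t)-\hat x(t)|\le K e^{-\alpha t}\,|x(0)-\hat x(0)|\qquad\text{for all } t\ge 0 .$$ -/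

import Mathlib

open scoped Matrix
open MeasureTheory

noncomputable section

/-- Euclidean space with coordinates indexed by `ι`. -/
abbrev Vec (ι : Type) : Type := EuclideanSpace ℝ ι

/-- `ż(t) = F(t)` on `[0, ∞)` in the sense of Carathéodory, for a scalar function `z`: `F` is locally
integrable and `z` is its primitive. If `F` is continuous, this says that `z` is differentiable
on `[0, ∞)` with derivative `F`. -/
def SolvesODE (z F : ℝ → ℝ) : Prop :=
  ∀ t : ℝ, 0 ≤ t → IntervalIntegrable F volume 0 t ∧ z t = z 0 + ∫ s in (0 : ℝ)..t, F s

/-- Jacobian matrix of `g` at `x`. -/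
def jacobian {ι κ : Type} [Fintype ι] [DecidableEq ι] [Fintype κ]
    (g : Vec ι → Vec κ) (x : Vec ι) : Matrix κ ι ℝ :=
  Matrix.of fun k i => fderiv ℝ g x (EuclideanSpace.single i 1) k

section Systems

variable {ι κ μ : Type} [Fintype ι] [DecidableEq ι] [Fintype κ]

/-- `x`, `y` are state and output trajectories of `ẋ = f(x,u)`, `y = h(x,u)` for the input `u`. -/
structure IsTrajectory (f : Vec ι → Vec μ → Vec ι) (h : Vec ι → Vec μ → Vec κ)
    (u : ℝ → Vec μ) (x : ℝ → Vec ι) (y : ℝ → Vec κ) : Prop where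
  state : ∀ i, SolvesODE (fun t => x t i) (fun t => f (x t) (u t) i)
  output : ∀ t, 0 ≤ t → y t = h (x t) (u t)

/-- Right-hand side of the estimate equation, `f(x̂,u) + P C' (y - h(x̂,u))`
with `C = ∂h/∂x (x̂,u)`. -/
def ekfEstimateRHS (f : Vec ι → Vec μ → Vec ι) (h : Vec ι → Vec μ → Vec κ)
    (u : Vec μ) (y : Vec κ) (xhat : Vec ι) (P : Matrix ι ι ℝ) : Vec ι :=
  f xhat u + WithLp.toLp 2
    ((P * (jacobian (fun z => h z u) xhat)ᵀ) *ᵥ (y - h xhat u).ofLp)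

/-- Right-hand side of the Riccati equation, `A P + P A' + G G' - P C' C P`
with `A = ∂f/∂x (x̂,u)` and `C = ∂h/∂x (x̂,u)`. -/
def ekfRiccatiRHS (f : Vec ι → Vec μ → Vec ι) (h : Vec ι → Vec μ → Vec κ)
    (G : Matrix ι ι ℝ) (u : Vec μ) (xhat : Vec ι) (P : Matrix ι ι ℝ) : Matrix ι ι ℝ :=
  jacobian (fun z => f z u) xhat * P + P * (jacobian (fun z => f z u) xhat)ᵀ + G * Gᵀ
    - P * (jacobian (fun z => h z u) xhat)ᵀ * jacobian (fun z => h z u) xhat * P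

/-- `x̂`, `P` solve the extended Kalman filter of `ẋ = f(x,u)`, `y = h(x,u)` with design matrix `G`,
driven by the input `u` and the output `y`. -/
structure IsEKF (f : Vec ι → Vec μ → Vec ι) (h : Vec ι → Vec μ → Vec κ) (G : Matrix ι ι ℝ)
    (u : ℝ → Vec μ) (y : ℝ → Vec κ) (xhat : ℝ → Vec ι) (P : ℝ → Matrix ι ι ℝ) : Prop where
  estimate : ∀ i, SolvesODE (fun t => xhat t i)
    (fun t => ekfEstimateRHS f h (u t) (y t) (xhat t) (P t) i)
  riccati : ∀ i j, SolvesODE (fun t => P t i j)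
    (fun t => ekfRiccatiRHS f h G (u t) (xhat t) (P t) i j)

end Systems

section ObservableForm

variable {p m : ℕ}

/-- Index set of the coordinates `x_{ij}`, `i = 1, …, p`, `j = 1, …, l_i`
(both indices are counted from `0` here). -/
abbrev Idx (l : Fin p → ℕ) : Type := Σ i : Fin p, Fin (l i)

/-- Index set of the coordinates `x_{ik}`, `k ≤ min(j, l_i)`, that make up `x̲_j`. -/
abbrev LowIdx (l : Fin p → ℕ) (j : ℕ) : Type := {r : Idx l // r.2.val ≤ j}

/-- The vector `x̲_j`. -/
def lowerCoords (l : Fin p → ℕ) (j : ℕ) (x : Vec (Idx l)) : Vec (LowIdx l j) :=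
  WithLp.toLp 2 fun r => x r.1

/-- A family of component functions `f_{ij}(x̲_j, u)`. -/
abbrev Components (l : Fin p → ℕ) (m : ℕ) : Type :=
  (s : Idx l) → Vec (LowIdx l s.2.val) → Vec (Fin m) → ℝ

/-- `f̄(x,u)`, the vector of all `f_{ij}(x̲_j, u)`. -/
def fBar (l : Fin p → ℕ) (f : Components l m) (x : Vec (Idx l)) (u : Vec (Fin m)) : Vec (Idx l) :=
  WithLp.toLp 2 fun s => f s (lowerCoords l s.2.val x) u

/-- `Ā`: block diagonal, the `i`-th block is the `l_i × l_i` matrix with ones on the first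
superdiagonal and zeros elsewhere. -/
def Abar (l : Fin p → ℕ) : Matrix (Idx l) (Idx l) ℝ :=
  Matrix.of fun s r => if s.1 = r.1 ∧ s.2.val + 1 = r.2.val then 1 else 0

/-- `C̄`: block diagonal, the `i`-th block is the `1 × l_i` row `(1, 0, …, 0)`. -/
def Cbar (l : Fin p → ℕ) : Matrix (Fin p) (Idx l) ℝ :=
  Matrix.of fun i r => if i = r.1 ∧ r.2.val = 0 then 1 else 0

/-- The vector field `Ā x + f̄(x,u)` of a system in observable form. -/
def obsField (l : Fin p → ℕ) (f : Components l m) (x : Vec (Idx l)) (u : Vec (Fin m)) :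
    Vec (Idx l) :=
  WithLp.toLp 2 (Abar l *ᵥ x.ofLp) + fBar l f x u

/-- The output map `C̄ x + h̄(u)` of a system in observable form. -/
def obsOutput (l : Fin p → ℕ) (h : Vec (Fin m) → Vec (Fin p)) (x : Vec (Idx l))
    (u : Vec (Fin m)) : Vec (Fin p) :=
  WithLp.toLp 2 (Cbar l *ᵥ x.ofLp) + h u

end ObservableForm

end

/-! With `e = x - x̂` and `r` the second-order Taylor remainder of `f̄` at `x̂`, the error obeys `ė
= (A - PC'C)e + r`, `|r| ≤ |L||e|²`. The Lyapunov function is `V = e'P⁻¹e`. By the Riccati equation,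
`V̇ = -|G'P⁻¹e|² - |Ce|² + 2(P⁻¹e)·r`. If `P` and `P⁻¹` are bounded uniformly in time, the first
term dominates a multiple of `V`, while the last is of order `|e|V`. Hence small errors decay
exponentially and stay small (`exists_exp_decay`).

The bounds on `P` and `P⁻¹` must not depend on the input or the trajectory
(`exists_riccati_bounds`). For `P⁻¹`, the equation for its trace contains `-|G'P⁻¹|²`, which is
quadratically damping because `G` is invertible; only boundedness of `A(t)` is needed
(`SolvesRiccati.trace_inv_le`). The same estimate keeps `P` positive definite
(`SolvesRiccati.posDef`).

The bound on `P` is where the observable form enters. A fixed positive definite `S` is found with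
`SA + A'S ≤ -S + bC'C` for every `A = Ā + J`, where `J` is bounded and has the triangular pattern of
`∂f̄/∂x` (`exists_highGain`). It is a weighted observability Gramian of `(Ā, C̄)`, rescaled by
powers of a large gain `θ`: the rescaling multiplies the contribution of `Ā` by `θ` but does not
enlarge `J`. Then `tr(SP)` satisfies a dissipative inequality, since the quadratic term `-PC'CP`
absorbs `b·tr(C'CP)` (`exists_trace_mul_le`). -/

/-! ### Differential inequalities for absolutely continuous functions. -/

section AbsolutelyContinuousCalculus

open Set

variable {E F : Type*} [NormedAddCommGroup E] [NormedSpace ℝ E]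
  [NormedAddCommGroup F] [NormedSpace ℝ F]

/-- `z` is absolutely continuous on `[0, T]` and has the derivative `z'` almost everywhere. -/
structure HasAEDerivOn (z z' : ℝ → E) (T : ℝ) : Prop where
  ac : AbsolutelyContinuousOnInterval z 0 T
  deriv : ∀ᵐ t, t ∈ Ioo 0 T → HasDerivAt z (z' t) t

namespace HasAEDerivOn

variable {z z' w w' : ℝ → E} {T : ℝ}

/-- The image of `z` is compact, so a map that is C¹ near it is Lipschitz on it, and Lipschitz maps
preserve absolute continuity. -/
theorem comp {g : E → F} {w : ℝ → F} (hT : 0 ≤ T) (hz : HasAEDerivOn z z' T)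
    (hg : ∀ t ∈ Icc 0 T, ContDiffAt ℝ 1 g (z t))
    (hw : ∀ t ∈ Ioo 0 T, HasDerivAt z (z' t) t → HasDerivAt (fun s => g (z s)) (w t) t) :
    HasAEDerivOn (fun t => g (z t)) w T := by
  refine ⟨?_, by filter_upwards [hz.deriv] with t ht hT using hw t hT (ht hT)⟩
  have hK : IsCompact (z '' uIcc 0 T) := isCompact_uIcc.image_of_continuousOn hz.ac.continuousOn
  have hloc : LocallyLipschitzOn (z '' uIcc 0 T) g := by
    rintro _ ⟨t, ht, rfl⟩
    rw [uIcc_of_le hT] at ht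
    obtain ⟨K, s, hs, hK⟩ := (hg t ht).exists_lipschitzOnWith
    exact ⟨K, s, mem_nhdsWithin_of_mem_nhds hs, hK⟩
  obtain ⟨K, hK⟩ := hloc.exists_lipschitzOnWith_of_compact hK
  have hac := hz.ac
  rw [absolutelyContinuousOnInterval_iff] at hac ⊢
  intro ε hε
  -- `K + 1` rather than `K`, since the Lipschitz constant may be zero.
  obtain ⟨δ, hδ, h⟩ := hac (ε / (K + 1)) (by positivity)
  refine ⟨δ, hδ, fun I hI hlt => ?_⟩
  have h1 := h I hI hlt
  rw [lt_div_iff₀ (by positivity)] at h1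
  refine lt_of_le_of_lt ?_ h1
  rw [Finset.sum_mul]
  refine Finset.sum_le_sum fun i hi => ?_
  have h2 := hK.dist_le_mul _ (mem_image_of_mem z (hI.1 i hi).1) _
    (mem_image_of_mem z (hI.1 i hi).2)
  nlinarith [dist_nonneg (x := z (I.2 i).1) (y := z (I.2 i).2)]

theorem clm_apply (L : E →L[ℝ] F) (hT : 0 ≤ T) (hz : HasAEDerivOn z z' T) :
    HasAEDerivOn (fun t => L (z t)) (fun t => L (z' t)) T :=
  hz.comp hT (fun _ _ => L.contDiff.contDiffAt)
    fun _ _ h => L.hasFDerivAt.comp_hasDerivAt _ h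

theorem add (hz : HasAEDerivOn z z' T) (hw : HasAEDerivOn w w' T) :
    HasAEDerivOn (fun t => z t + w t) (fun t => z' t + w' t) T :=
  ⟨hz.ac.add hw.ac, by
    filter_upwards [hz.deriv, hw.deriv] with t h1 h2 hT using (h1 hT).add (h2 hT)⟩

theorem sub (hz : HasAEDerivOn z z' T) (hw : HasAEDerivOn w w' T) :
    HasAEDerivOn (fun t => z t - w t) (fun t => z' t - w' t) T :=
  ⟨hz.ac.sub hw.ac, by
    filter_upwards [hz.deriv, hw.deriv] with t h1 h2 hT using (h1 hT).sub (h2 hT)⟩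

theorem const (c : E) : HasAEDerivOn (fun _ => c) (fun _ => 0) T :=
  ⟨by
    refine LipschitzOnWith.absolutelyContinuousOnInterval (K := 0) fun x _ y _ => by simp,
    .of_forall fun t _ => hasDerivAt_const t c⟩

theorem sum {ι : Type*} (s : Finset ι) {z z' : ι → ℝ → E}
    (h : ∀ i ∈ s, HasAEDerivOn (z i) (z' i) T) :
    HasAEDerivOn (fun t => ∑ i ∈ s, z i t) (fun t => ∑ i ∈ s, z' i t) T := by
  classical
  induction s using Finset.induction_on with
  | empty => simpa using const (0 : E)
  | insert a s ha ih =>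
    simp only [Finset.sum_insert ha]
    exact (h a (by simp)).add (ih fun i hi => h i (by simp [hi]))

theorem mul {f f' g g' : ℝ → ℝ} (hf : HasAEDerivOn f f' T) (hg : HasAEDerivOn g g' T) :
    HasAEDerivOn (fun t => f t * g t) (fun t => f' t * g t + f t * g' t) T :=
  ⟨hf.ac.mul hg.ac, by
    filter_upwards [hf.deriv, hg.deriv] with t h1 h2 hT using (h1 hT).mul (h2 hT)⟩

theorem prodMk {w w' : ℝ → F} (hT : 0 ≤ T) (hz : HasAEDerivOn z z' T)
    (hw : HasAEDerivOn w w' T) :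
    HasAEDerivOn (fun t => (z t, w t)) (fun t => (z' t, w' t)) T := by
  simpa using (hz.clm_apply (ContinuousLinearMap.inl ℝ E F) hT).add
    (hw.clm_apply (ContinuousLinearMap.inr ℝ E F) hT)

theorem continuousOn (hT : 0 ≤ T) (hz : HasAEDerivOn z z' T) : ContinuousOn z (Icc 0 T) := by
  simpa [uIcc_of_le hT] using hz.ac.continuousOn

theorem le_of_deriv_nonpos {f f' : ℝ → ℝ} (hT : 0 ≤ T) (hf : HasAEDerivOn f f' T)
    (h : ∀ t ∈ Ioo 0 T, f' t ≤ 0) : f T ≤ f 0 := by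
  have h1 := hf.ac.integral_deriv_eq_sub
  have h2 : ∫ t in (0 : ℝ)..T, _root_.deriv f t ≤ 0 := by
    rw [intervalIntegral.integral_of_le hT, integral_Ioc_eq_integral_Ioo]
    refine integral_nonpos_of_ae ?_
    rw [Filter.EventuallyLE, ae_restrict_iff' measurableSet_Ioo]
    filter_upwards [hf.deriv] with t ht hT'
    rw [(ht hT').deriv]
    exact h t hT'
  linarith

theorem le_exp_mul {f f' : ℝ → ℝ} {c : ℝ} (hT : 0 ≤ T) (hf : HasAEDerivOn f f' T)
    (h : ∀ t ∈ Ioo 0 T, f' t ≤ c * f t) : f T ≤ Real.exp (c * T) * f 0 := by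
  have hexp : HasAEDerivOn (fun t => Real.exp (-(c * t)))
      (fun t => Real.exp (-(c * t)) * (-(c * 1))) T :=
    ⟨ContDiffOn.absolutelyContinuousOnInterval (by fun_prop), .of_forall fun t _ =>
      (((hasDerivAt_id t).const_mul c).neg).exp⟩
  have h1 := (hexp.mul hf).le_of_deriv_nonpos hT fun t ht => by
    have := mul_le_mul_of_nonneg_left (h t ht) (Real.exp_pos (-(c * t))).le
    linarith
  simp only [mul_zero, neg_zero, Real.exp_zero, one_mul] at h1
  calc f T = Real.exp (c * T) * (Real.exp (-(c * T)) * f T) := by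
        rw [← mul_assoc, ← Real.exp_add]; simp
    _ ≤ _ := mul_le_mul_of_nonneg_left h1 (Real.exp_pos _).le

/-- The difference `f - k` decays at rate one, so `f T` is at most `e⁻ᵀ f 0 + (1 - e⁻ᵀ) k`. Both
trace bounds for the Riccati equation come from this inequality, uniformly in `T`. -/
theorem le_add_of_deriv_le {f f' : ℝ → ℝ} {k : ℝ} (hT : 0 ≤ T) (hf : HasAEDerivOn f f' T)
    (h0 : 0 ≤ f 0) (hk : 0 ≤ k) (h : ∀ t ∈ Ioo 0 T, f' t ≤ -f t + k) : f T ≤ f 0 + k := by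
  have h1 := (hf.sub (const k)).le_exp_mul (c := -1) hT fun t ht => by linarith [h t ht]
  have h2 : Real.exp (-1 * T) ≤ 1 := Real.exp_le_one_iff.2 (by linarith)
  nlinarith [Real.exp_pos (-1 * T)]

end HasAEDerivOn

theorem SolvesODE.hasAEDerivOn {z F : ℝ → ℝ} (h : SolvesODE z F) {T : ℝ} (hT : 0 ≤ T) :
    HasAEDerivOn z F T := by
  obtain ⟨hF, -⟩ := h T hT
  constructor
  · have h1 := (HasAEDerivOn.const (z 0) (T := T)).ac.add
      (hF.absolutelyContinuousOnInterval_intervalIntegral left_mem_uIcc)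
    rw [absolutelyContinuousOnInterval_iff] at h1 ⊢
    intro ε hε
    obtain ⟨δ, hδ, h2⟩ := h1 ε hε
    refine ⟨δ, hδ, fun I hI hlt => ?_⟩
    convert h2 I hI hlt using 1
    refine Finset.sum_congr rfl fun i hi => ?_
    have h3 := hI.1 i hi
    rw [uIcc_of_le hT] at h3
    rw [(h _ h3.1.1).2, (h _ h3.2.1).2]
    rfl
  · filter_upwards [hF.ae_hasDerivAt_integral] with t ht hT'
    have h1 := ht (Icc_subset_uIcc ⟨hT'.1.le, hT'.2.le⟩) 0 left_mem_uIcc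
    refine (h1.const_add (z 0)).congr_of_eventuallyEq ?_
    filter_upwards [lt_mem_nhds hT'.1] with s hs using (h s hs.le).2

end AbsolutelyContinuousCalculus

/-! ### Quadratic forms of positive semidefinite matrices, with the trace as upper bound. -/

section QuadraticForms

open Matrix

variable {ι κ : Type*} [Fintype ι] [Fintype κ]

theorem Matrix.trace_mul_vecMulVec (M : Matrix ι ι ℝ) (v w : ι → ℝ) :
    (M * vecMulVec v w).trace = w ⬝ᵥ M *ᵥ v := by
  rw [mul_vecMulVec, trace_vecMulVec, dotProduct_comm]

theorem sq_dotProduct_le (v w : ι → ℝ) : (v ⬝ᵥ w) ^ 2 ≤ (v ⬝ᵥ v) * (w ⬝ᵥ w) := by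
  simpa [dotProduct, sq] using Finset.sum_mul_sq_le_sq_mul_sq Finset.univ v w

theorem dotProduct_self_real_nonneg (v : ι → ℝ) : 0 ≤ v ⬝ᵥ v :=
  Finset.sum_nonneg fun i _ => mul_self_nonneg (v i)

theorem dotProduct_self_mulVec (M : Matrix κ ι ℝ) (v : ι → ℝ) :
    (M *ᵥ v) ⬝ᵥ (M *ᵥ v) = v ⬝ᵥ (Mᵀ * M) *ᵥ v := by
  rw [← mulVec_mulVec, dotProduct_mulVec v, vecMul_transpose]

/-- Writing `P = ∑ vᵢvᵢ'` turns the trace into `∑ vᵢ'Mvᵢ`. Only quadratic forms are compared, so `M`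
and `N` need not be symmetric. -/
theorem Matrix.PosSemidef.trace_mul_le {P : Matrix ι ι ℝ} (hP : P.PosSemidef)
    {M N : Matrix ι ι ℝ} (h : ∀ v : ι → ℝ, v ⬝ᵥ M *ᵥ v ≤ v ⬝ᵥ N *ᵥ v) :
    (M * P).trace ≤ (N * P).trace := by
  obtain ⟨n, v, rfl⟩ := posSemidef_iff_eq_sum_vecMulVec.1 hP
  simp only [Finset.mul_sum, trace_sum, star_trivial, trace_mul_vecMulVec]
  exact Finset.sum_le_sum fun i _ => h (v i)

theorem dotProduct_sum_vecMulVec {n : ℕ} (w : Fin n → ι → ℝ) (x y : ι → ℝ) :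
    x ⬝ᵥ (∑ i, vecMulVec (w i) (w i)) *ᵥ y = ∑ i, (w i ⬝ᵥ x) * (w i ⬝ᵥ y) := by
  simp only [sum_mulVec, dotProduct_sum, vecMulVec_mulVec]
  refine Finset.sum_congr rfl fun i _ => ?_
  simp [dotProduct_comm x, mul_comm]

theorem Matrix.PosSemidef.dotProduct_mulVec_le {R : Matrix ι ι ℝ} (hR : R.PosSemidef)
    (v : ι → ℝ) : v ⬝ᵥ R *ᵥ v ≤ R.trace * (v ⬝ᵥ v) := by
  obtain ⟨n, w, rfl⟩ := posSemidef_iff_eq_sum_vecMulVec.1 hR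
  simp only [star_trivial, dotProduct_sum_vecMulVec, trace_sum, trace_vecMulVec, Finset.sum_mul]
  exact Finset.sum_le_sum fun i _ => by simpa [sq] using sq_dotProduct_le (w i) v

/-- Cauchy–Schwarz for the form `R`, applied to `Rv` and `v`, bounds `|Rv|⁴`; one factor `|Rv|²`
then cancels. -/
theorem Matrix.PosSemidef.mulVec_dotProduct_self_le {R : Matrix ι ι ℝ} (hR : R.PosSemidef)
    (v : ι → ℝ) : (R *ᵥ v) ⬝ᵥ (R *ᵥ v) ≤ R.trace * (v ⬝ᵥ R *ᵥ v) := by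
  have h1 := hR.dotProduct_mulVec_le (R *ᵥ v)
  have h2 : ∀ x, (x ⬝ᵥ R *ᵥ v) ^ 2 ≤ (x ⬝ᵥ R *ᵥ x) * (v ⬝ᵥ R *ᵥ v) := by
    intro x
    obtain ⟨n, w, rfl⟩ := posSemidef_iff_eq_sum_vecMulVec.1 hR
    simp only [star_trivial, dotProduct_sum_vecMulVec]
    simpa [sq] using Finset.sum_mul_sq_le_sq_mul_sq Finset.univ (fun i => w i ⬝ᵥ x)
      (fun i => w i ⬝ᵥ v)
  replace h2 := h2 (R *ᵥ v)
  have h3 : 0 ≤ v ⬝ᵥ R *ᵥ v := by simpa using hR.dotProduct_mulVec_nonneg v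
  have h4 := hR.trace_nonneg
  have h5 := dotProduct_self_real_nonneg (R *ᵥ v)
  rcases h5.eq_or_lt with h6 | h6
  · rw [← h6]; positivity
  · refine le_of_mul_le_mul_left ?_ h6
    nlinarith [mul_le_mul_of_nonneg_right h1 h3]

variable [DecidableEq ι]

theorem Matrix.PosDef.dotProduct_self_le_inv {R : Matrix ι ι ℝ} (hR : R.PosDef) (v : ι → ℝ) :
    v ⬝ᵥ v ≤ R.trace * (v ⬝ᵥ R⁻¹ *ᵥ v) := by
  have h := hR.posSemidef.mulVec_dotProduct_self_le (R⁻¹ *ᵥ v)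
  have hu := (isUnit_iff_isUnit_det R).1 hR.isUnit
  rwa [mulVec_mulVec, mul_nonsing_inv _ hu, one_mulVec, dotProduct_comm (R⁻¹ *ᵥ v)] at h

theorem Matrix.PosDef.dotProduct_self_le {R : Matrix ι ι ℝ} (hR : R.PosDef) (v : ι → ℝ) :
    v ⬝ᵥ v ≤ R⁻¹.trace * (v ⬝ᵥ R *ᵥ v) := by
  have h := hR.inv.dotProduct_self_le_inv v
  rwa [nonsing_inv_nonsing_inv _ ((isUnit_iff_isUnit_det R).1 hR.isUnit)] at h

theorem Matrix.PosDef.exists_pos_mul_le {R : Matrix ι ι ℝ} (hR : R.PosDef) :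
    ∃ c > 0, ∀ v : ι → ℝ, c * (v ⬝ᵥ v) ≤ v ⬝ᵥ R *ᵥ v := by
  have h0 := hR.inv.posSemidef.trace_nonneg
  refine ⟨(R⁻¹.trace + 1)⁻¹, by positivity, fun v => ?_⟩
  rw [inv_mul_le_iff₀ (by positivity)]
  have h1 : 0 ≤ v ⬝ᵥ R *ᵥ v := by simpa using hR.posSemidef.dotProduct_mulVec_nonneg v
  linarith [hR.dotProduct_self_le v]

end QuadraticForms

/-! ### Frobenius norm and differentiation of matrix-valued functions. -/

section MatrixCalculus

open Matrix Set

variable {ι κ : Type*} [Fintype ι] [Fintype κ]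

attribute [local instance] Matrix.frobeniusNormedAddCommGroup Matrix.frobeniusNormedSpace
  Matrix.frobeniusNormedRing Matrix.frobeniusNormedAlgebra

theorem frobenius_norm_sq (M : Matrix ι κ ℝ) : ‖M‖ ^ 2 = (Mᵀ * M).trace := by
  rw [frobenius_norm_def, ← Real.sqrt_eq_rpow, Real.sq_sqrt (by positivity)]
  simp only [trace, diag, mul_apply, transpose_apply, Real.rpow_two, Real.norm_eq_abs, sq_abs]
  rw [Finset.sum_comm]
  simp [sq]

theorem trace_transpose_mul_le (M N : Matrix ι κ ℝ) : (Mᵀ * N).trace ≤ ‖M‖ * ‖N‖ := by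
  refine le_of_sq_le_sq ?_ (by positivity)
  rw [mul_pow, frobenius_norm_sq, frobenius_norm_sq]
  have h : ∀ A B : Matrix ι κ ℝ, (Aᵀ * B).trace = ∑ x : κ × ι, A x.2 x.1 * B x.2 x.1 := by
    intro A B
    simp [trace, mul_apply, Fintype.sum_prod_type]
  simp only [h]
  simpa [sq] using Finset.sum_mul_sq_le_sq_mul_sq Finset.univ (fun x : κ × ι => M x.2 x.1)
    (fun x : κ × ι => N x.2 x.1)

theorem dotProduct_mulVec_le_norm (M : Matrix ι ι ℝ) (v : ι → ℝ) :
    v ⬝ᵥ M *ᵥ v ≤ ‖M‖ * (v ⬝ᵥ v) := by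
  have h := trace_transpose_mul_le Mᵀ (vecMulVec v v)
  rw [transpose_transpose, trace_mul_vecMulVec, frobenius_norm_transpose] at h
  have h2 : ‖vecMulVec v v‖ = v ⬝ᵥ v := by
    refine (sq_eq_sq₀ (norm_nonneg _) (dotProduct_self_real_nonneg v)).1 ?_
    rw [frobenius_norm_sq, transpose_vecMulVec, trace_mul_vecMulVec, vecMulVec_mulVec]
    simp [sq]
  rwa [h2] at h

theorem norm_le_of_entry_le {M : Matrix ι κ ℝ} {a : ℝ} (h : ∀ i j, |M i j| ≤ a) :
    ‖M‖ ≤ Fintype.card ι * (Fintype.card κ * a) := by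
  classical
  calc ‖M‖ = ‖∑ i, ∑ j, single i j (M i j)‖ := by rw [← matrix_eq_sum_single]
    _ ≤ ∑ _i : ι, ∑ _j : κ, a := by
      refine (norm_sum_le _ _).trans (Finset.sum_le_sum fun i _ => (norm_sum_le _ _).trans
        (Finset.sum_le_sum fun j _ => ?_))
      refine le_trans (le_of_eq ?_) (h i j)
      rw [frobenius_norm_def, ← Real.sqrt_eq_rpow]
      rw [Finset.sum_eq_single i, Finset.sum_eq_single j]
      · simp [Real.sqrt_sq_eq_abs]
      · intro k _ hk
        simp [hk.symm]
      · simp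
      · intro k _ hk
        simp [hk.symm]
      · simp
    _ = _ := by simp

theorem HasAEDerivOn.matrix {M M' : ℝ → Matrix ι κ ℝ} {T : ℝ} (hT : 0 ≤ T)
    (h : ∀ i j, HasAEDerivOn (fun t => M t i j) (fun t => M' t i j) T) :
    HasAEDerivOn M M' T := by
  classical
  have h1 := HasAEDerivOn.sum Finset.univ fun i _ => HasAEDerivOn.sum Finset.univ fun j _ =>
    (h i j).clm_apply ((ContinuousLinearMap.id ℝ ℝ).smulRight (single i j (1 : ℝ))) hT
  simp only [ContinuousLinearMap.smulRight_apply, ContinuousLinearMap.coe_id', id, smul_single,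
    smul_eq_mul, mul_one] at h1
  simpa only [← matrix_eq_sum_single] using h1

variable [DecidableEq ι]

/-- The trace as a continuous linear map. -/
noncomputable def traceCLM (ι : Type*) [Fintype ι] [DecidableEq ι] : Matrix ι ι ℝ →L[ℝ] ℝ :=
  LinearMap.toContinuousLinearMap (traceLinearMap ι ℝ ℝ)

theorem HasAEDerivOn.trace_mul_left {M M' : ℝ → Matrix ι ι ℝ} {T : ℝ} (hT : 0 ≤ T)
    (hM : HasAEDerivOn M M' T) (S : Matrix ι ι ℝ) :
    HasAEDerivOn (fun t => (S * M t).trace) (fun t => (S * M' t).trace) T := by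
  exact hM.clm_apply ((traceCLM ι).comp (ContinuousLinearMap.mul ℝ (Matrix ι ι ℝ) S)) hT

/-- Needed twice: `X = 1` gives the trace of `P⁻¹`, and `X = ee'` gives the Lyapunov function
`e'P⁻¹e`. -/
theorem HasAEDerivOn.trace_inv_mul {P P' X X' : ℝ → Matrix ι ι ℝ} {T : ℝ} (hT : 0 ≤ T)
    (hP : HasAEDerivOn P P' T) (hX : HasAEDerivOn X X' T) (hu : ∀ t ∈ Icc 0 T, IsUnit (P t)) :
    HasAEDerivOn (fun t => ((P t)⁻¹ * X t).trace)
      (fun t => (-((P t)⁻¹ * P' t * (P t)⁻¹) * X t + (P t)⁻¹ * X' t).trace) T := by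
  let E := Matrix ι ι ℝ
  have hz := hP.prodMk hT hX
  refine hz.comp (g := fun q => (q.1⁻¹ * q.2).trace) hT (fun t ht => ?_) fun t ht h => ?_
  · simp only [nonsing_inv_eq_ringInverse]
    obtain ⟨v, hv⟩ := hu t ht
    have h1 : ContDiffAt ℝ 1 (Ring.inverse : E → E) (P t) := hv ▸ contDiffAt_ringInverse ℝ v
    have h2 : ContDiffAt ℝ 1 (fun q : E × E => Ring.inverse q.1 * q.2) (P t, X t) :=
      (h1.comp (P t, X t) contDiffAt_fst).mul contDiffAt_snd
    exact (traceCLM ι).contDiff.contDiffAt.comp (P t, X t) h2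
  · simp only [nonsing_inv_eq_ringInverse]
    obtain ⟨v, hv⟩ := hu t ⟨ht.1.le, ht.2.le⟩
    have hP1 : HasDerivAt P (P' t) t := h.fst
    have hX1 : HasDerivAt X (X' t) t := h.snd
    have h1 : HasDerivAt (fun s => Ring.inverse (P s))
        (-(Ring.inverse (P t) * P' t * Ring.inverse (P t))) t := by
      have h2 := hasFDerivAt_ringInverse (𝕜 := ℝ) v
      rw [hv] at h2
      have h3 := h2.comp_hasDerivAt t hP1
      rw [← hv, Ring.inverse_unit]
      exact h3
    exact (traceCLM ι).hasFDerivAt.comp_hasDerivAt t (h1.mul hX1)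

end MatrixCalculus

/-! ### A priori bounds for the Riccati equation. -/

section Riccati

open Matrix Set

variable {ι κ : Type*} [Fintype ι] [Fintype κ]

attribute [local instance] Matrix.frobeniusNormedAddCommGroup Matrix.frobeniusNormedSpace
  Matrix.frobeniusNormedRing Matrix.frobeniusNormedAlgebra

/-- Right-hand side of the Riccati equation of the pair `(A, C)` with design matrix `G`. -/
def riccatiRHS (A : Matrix ι ι ℝ) (C : Matrix κ ι ℝ) (G P : Matrix ι ι ℝ) : Matrix ι ι ℝ :=
  A * P + P * Aᵀ + G * Gᵀ - P * Cᵀ * C * P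

/-- `P` solves the Riccati equation with the coefficients `A`, `C`, `G`. -/
def SolvesRiccati (A : ℝ → Matrix ι ι ℝ) (C : Matrix κ ι ℝ) (G : Matrix ι ι ℝ)
    (P : ℝ → Matrix ι ι ℝ) : Prop :=
  ∀ i j, SolvesODE (fun t => P t i j) (fun t => riccatiRHS (A t) C G (P t) i j)

variable {A : ℝ → Matrix ι ι ℝ} {C : Matrix κ ι ℝ} {G : Matrix ι ι ℝ} {P : ℝ → Matrix ι ι ℝ}

theorem SolvesRiccati.hasAEDerivOn (hP : SolvesRiccati A C G P) {T : ℝ} (hT : 0 ≤ T) :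
    HasAEDerivOn P (fun t => riccatiRHS (A t) C G (P t)) T :=
  .matrix hT fun i j => (hP i j).hasAEDerivOn hT

/-- The antisymmetric part `D = P - P'` solves the linear equation `Ḋ = AD + DA' - DC'CP - P'C'CD`
and vanishes initially. Its coefficients are bounded on `[0, T]`, so Grönwall's inequality for
`‖D‖²` gives `D = 0`. -/
theorem SolvesRiccati.transpose_eq (hP : SolvesRiccati A C G P) (h0 : (P 0)ᵀ = P 0) {a : ℝ}
    (hA : ∀ t, 0 ≤ t → ‖A t‖ ≤ a) {T : ℝ} (hT : 0 ≤ T) : (P T)ᵀ = P T := by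
  obtain ⟨p, hp⟩ := (hP.hasAEDerivOn hT).ac.exists_bound
  let R : ℝ → Matrix ι ι ℝ := fun t => riccatiRHS (A t) C G (P t)
  have h1 := HasAEDerivOn.sum Finset.univ fun j _ => HasAEDerivOn.sum Finset.univ fun i _ =>
    (((hP i j).hasAEDerivOn hT).sub ((hP j i).hasAEDerivOn hT)).mul
      (((hP i j).hasAEDerivOn hT).sub ((hP j i).hasAEDerivOn hT))
  have hφ : ∀ t, ∑ j, ∑ i, (P t i j - P t j i) * (P t i j - P t j i)
      = ‖P t - (P t)ᵀ‖ ^ 2 := by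
    intro t
    rw [frobenius_norm_sq]
    simp [trace, mul_apply]
  have hφ' : ∀ t, ∑ j, ∑ i, ((R t i j - R t j i) * (P t i j - P t j i)
      + (P t i j - P t j i) * (R t i j - R t j i))
      = 2 * ((P t - (P t)ᵀ)ᵀ * (R t - (R t)ᵀ)).trace := by
    intro t
    simp only [trace, diag, mul_apply, transpose_apply, Matrix.sub_apply, Finset.mul_sum]
    refine Finset.sum_congr rfl fun j _ => Finset.sum_congr rfl fun i _ => by ring
  have h2 := h1.le_exp_mul (c := 2 * (2 * a + 2 * (‖Cᵀ * C‖ * p))) hT fun t ht => by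
    have hpt : ‖P t‖ ≤ p := hp t (Icc_subset_uIcc ⟨ht.1.le, ht.2.le⟩)
    have hat := hA t ht.1.le
    refine (hφ' t).trans_le ?_
    rw [hφ t]
    have h3 := trace_transpose_mul_le (P t - (P t)ᵀ) (R t - (R t)ᵀ)
    have h4 : R t - (R t)ᵀ = A t * (P t - (P t)ᵀ) + (P t - (P t)ᵀ) * (A t)ᵀ
        - ((P t - (P t)ᵀ) * (Cᵀ * C) * P t + (P t)ᵀ * (Cᵀ * C) * (P t - (P t)ᵀ)) := by
      simp only [R, riccatiRHS, transpose_sub, transpose_add, transpose_mul, transpose_transpose]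
      simp only [Matrix.mul_sub, Matrix.sub_mul, Matrix.mul_assoc]
      abel
    have h5 : ‖R t - (R t)ᵀ‖ ≤ (2 * a + 2 * (‖Cᵀ * C‖ * p)) * ‖P t - (P t)ᵀ‖ := by
      rw [h4]
      generalize hD : P t - (P t)ᵀ = D
      have e1 : ‖A t * D‖ ≤ a * ‖D‖ := (frobenius_norm_mul _ _).trans (by gcongr)
      have e2 : ‖D * (A t)ᵀ‖ ≤ a * ‖D‖ := by
        refine (frobenius_norm_mul _ _).trans ?_
        rw [frobenius_norm_transpose, mul_comm]
        gcongr
      have e3 : ‖D * (Cᵀ * C) * P t‖ ≤ ‖Cᵀ * C‖ * p * ‖D‖ := by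
        refine (frobenius_norm_mul _ _).trans ?_
        calc _ ≤ ‖D‖ * ‖Cᵀ * C‖ * p := by
              gcongr; exact frobenius_norm_mul _ _
          _ = _ := by ring
      have e4 : ‖(P t)ᵀ * (Cᵀ * C) * D‖ ≤ ‖Cᵀ * C‖ * p * ‖D‖ := by
        refine (frobenius_norm_mul _ _).trans ?_
        calc _ ≤ p * ‖Cᵀ * C‖ * ‖D‖ := by
              gcongr
              refine (frobenius_norm_mul _ _).trans ?_
              rw [frobenius_norm_transpose]
              gcongr
          _ = _ := by ring
      refine (norm_sub_le _ _).trans ?_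
      linarith [norm_add_le (A t * D) (D * (A t)ᵀ),
        norm_add_le (D * (Cᵀ * C) * P t) ((P t)ᵀ * (Cᵀ * C) * D)]
    nlinarith [mul_le_mul_of_nonneg_left h5 (norm_nonneg (P t - (P t)ᵀ))]
  rw [hφ, hφ, h0] at h2
  simp only [sub_self, norm_zero, ne_eq, OfNat.ofNat_ne_zero, not_false_eq_true, zero_pow,
    mul_zero] at h2
  have h6 : ‖P T - (P T)ᵀ‖ = 0 := by nlinarith [norm_nonneg (P T - (P T)ᵀ)]
  exact (sub_eq_zero.1 (norm_eq_zero.1 h6)).symm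

theorem Matrix.PosDef.of_mul_le {R : Matrix ι ι ℝ} (hR : Rᵀ = R) {ε : ℝ} (hε : 0 < ε)
    (h : ∀ v : ι → ℝ, ε * (v ⬝ᵥ v) ≤ v ⬝ᵥ R *ᵥ v) : R.PosDef := by
  refine .of_dotProduct_mulVec_pos (by simpa [IsHermitian] using hR) fun v hv => ?_
  have h1 : 0 < v ⬝ᵥ v :=
    (dotProduct_self_real_nonneg v).lt_of_ne fun h => hv (dotProduct_self_eq_zero.1 h.symm)
  exact lt_of_lt_of_le (by positivity) (h v)

variable [DecidableEq ι]

theorem inv_mul_riccatiRHS_mul_inv {A P : Matrix ι ι ℝ} (hP : IsUnit P) :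
    P⁻¹ * riccatiRHS A C G P * P⁻¹ = P⁻¹ * A + Aᵀ * P⁻¹ + P⁻¹ * G * Gᵀ * P⁻¹ - Cᵀ * C := by
  have hu := (isUnit_iff_isUnit_det P).1 hP
  have e1 : ∀ M : Matrix ι ι ℝ, P⁻¹ * (P * M) = M := (nonsing_inv_mul_cancel_left P · hu)
  simp [riccatiRHS, Matrix.mul_add, Matrix.add_mul, Matrix.mul_sub, Matrix.sub_mul,
    Matrix.mul_assoc, e1, mul_nonsing_inv _ hu]

/-- Bound for the growth of the trace of the inverse of a solution of the Riccati equation. -/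
noncomputable def infoBound (a : ℝ) (C : Matrix κ ι ℝ) (G : Matrix ι ι ℝ) : ℝ :=
  ((2 * a + 1) * (‖(1 : Matrix ι ι ℝ)‖ * ‖(Gᵀ)⁻¹‖)) ^ 2 + (Cᵀ * C).trace

theorem infoBound_nonneg (a : ℝ) (C : Matrix κ ι ℝ) (G : Matrix ι ι ℝ) :
    0 ≤ infoBound a C G := by
  rw [infoBound, ← frobenius_norm_sq]
  positivity

/-- For `Q = P⁻¹`, `tr Q̇` is at most `2a·tr Q - ‖G'Q‖² + tr(C'C)`. Since `G` is invertible, `tr Q`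
is at most a multiple of `‖G'Q‖`, so the quadratic term beats `(2a + 1)·tr Q` up to a constant. -/
theorem SolvesRiccati.trace_inv_le (hP : SolvesRiccati A C G P) (hG : IsUnit G) {a : ℝ}
    (hA : ∀ t, 0 ≤ t → ‖A t‖ ≤ a) {T : ℝ} (hT : 0 ≤ T) (hpos : ∀ t ∈ Icc 0 T, (P t).PosDef) :
    (P T)⁻¹.trace ≤ (P 0)⁻¹.trace + infoBound a C G := by
  have h1 := (hP.hasAEDerivOn hT).trace_inv_mul hT (.const 1) fun t ht => (hpos t ht).isUnit
  simp only [mul_one, mul_zero, add_zero, trace_neg] at h1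
  refine h1.le_add_of_deriv_le hT (hpos 0 ⟨le_rfl, hT⟩).inv.posSemidef.trace_nonneg
    (infoBound_nonneg a C G) fun t ht => ?_
  have hPt := hpos t ⟨ht.1.le, ht.2.le⟩
  rw [inv_mul_riccatiRHS_mul_inv hPt.isUnit]
  have hQ := hPt.inv.posSemidef
  have hQt : ((P t)⁻¹)ᵀ = (P t)⁻¹ := by simpa using hQ.isHermitian.eq
  generalize (P t)⁻¹ = Q at hQ hQt ⊢
  have ha := hA t ht.1.le
  have e0 : ∀ B : Matrix ι ι ℝ, ‖B‖ ≤ a → -(B * Q).trace ≤ a * Q.trace := by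
    intro B hB
    have h2 := hQ.trace_mul_le (M := -B) (N := a • 1) fun v => by
      have h3 := dotProduct_mulVec_le_norm (-B) v
      rw [norm_neg] at h3
      refine h3.trans ?_
      simp only [smul_mulVec, one_mulVec, dotProduct_smul, smul_eq_mul]
      exact mul_le_mul_of_nonneg_right hB (dotProduct_self_real_nonneg v)
    simpa using h2
  have e1 := e0 (A t) ha
  have e2 := e0 (A t)ᵀ (by rwa [frobenius_norm_transpose])
  have e3 : (Q * G * Gᵀ * Q).trace = ‖Gᵀ * Q‖ ^ 2 := by
    rw [frobenius_norm_sq, transpose_mul, transpose_transpose, hQt]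
    simp only [Matrix.mul_assoc]
  have e4 : Q.trace ≤ ‖(1 : Matrix ι ι ℝ)‖ * ‖(Gᵀ)⁻¹‖ * ‖Gᵀ * Q‖ := by
    have hu : IsUnit (Gᵀ).det := by
      rw [det_transpose]; exact (isUnit_iff_isUnit_det G).1 hG
    have h2 := trace_transpose_mul_le 1 Q
    rw [transpose_one, one_mul] at h2
    have h3 := frobenius_norm_mul (Gᵀ)⁻¹ (Gᵀ * Q)
    rw [nonsing_inv_mul_cancel_left _ _ hu] at h3
    rw [mul_assoc]
    exact h2.trans (mul_le_mul_of_nonneg_left h3 (norm_nonneg _))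
  have ha0 : 0 ≤ a := (norm_nonneg _).trans ha
  rw [trace_sub, trace_add, trace_add, e3, trace_mul_comm Q (A t), infoBound]
  generalize ‖(1 : Matrix ι ι ℝ)‖ * ‖(Gᵀ)⁻¹‖ = b at e4 ⊢
  nlinarith [mul_le_mul_of_nonneg_left e4 (by linarith : 0 ≤ 2 * a + 1),
    sq_nonneg ((2 * a + 1) * b - ‖Gᵀ * Q‖), sq_nonneg ((2 * a + 1) * b),
    sq_nonneg ((2 * a + 1) * b - 2 * ‖Gᵀ * Q‖)]

/-- Continuation argument: while `P` is positive definite, `tr P⁻¹` stays bounded, so `P` stays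
above a fixed multiple of the identity and cannot reach the boundary of the cone. -/
theorem SolvesRiccati.posDef (hP : SolvesRiccati A C G P) (hG : IsUnit G) {a : ℝ}
    (hA : ∀ t, 0 ≤ t → ‖A t‖ ≤ a) (h0 : (P 0).PosDef) {T : ℝ} (hT : 0 ≤ T) : (P T).PosDef := by
  have hsymm : ∀ t, 0 ≤ t → (P t)ᵀ = P t := fun t ht =>
    hP.transpose_eq (by simpa using h0.isHermitian.eq) hA ht
  have htr0 := h0.inv.posSemidef.trace_nonneg
  have hk := infoBound_nonneg a C G
  -- The summand `1` ensures that `M` is positive even for an empty index set.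
  set M := (P 0)⁻¹.trace + infoBound a C G + 1 with hM
  have hMpos : 0 < M := by positivity
  have hcont : ContinuousOn P (Icc 0 T) := (hP.hasAEDerivOn hT).continuousOn hT
  let S : Set ℝ := {t | ∀ v : ι → ℝ, M⁻¹ * (v ⬝ᵥ v) ≤ v ⬝ᵥ P t *ᵥ v}
  have key : ∀ R : Matrix ι ι ℝ, R.PosDef → R⁻¹.trace ≤ M →
      ∀ v : ι → ℝ, M⁻¹ * (v ⬝ᵥ v) ≤ v ⬝ᵥ R *ᵥ v := by
    intro R hR hRM v
    rw [inv_mul_le_iff₀ hMpos]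
    have h1 : 0 ≤ v ⬝ᵥ R *ᵥ v := by simpa using hR.posSemidef.dotProduct_mulVec_nonneg v
    exact (hR.dotProduct_self_le v).trans (mul_le_mul_of_nonneg_right hRM h1)
  have hS : Icc 0 T ⊆ S := by
    refine IsClosed.Icc_subset_of_forall_mem_nhdsGT_of_Icc_subset ?_
      (key _ h0 (by linarith)) fun t ht hsub => ?_
    · have : S ∩ Icc 0 T = Icc 0 T ∩ ⋂ v : ι → ℝ,
          (Icc 0 T ∩ (fun t => v ⬝ᵥ P t *ᵥ v) ⁻¹' Ici (M⁻¹ * (v ⬝ᵥ v))) := by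
        ext t
        simp only [S, mem_inter_iff, mem_ofPred_eq, mem_iInter, mem_preimage, mem_Ici]
        exact ⟨fun h => ⟨h.2, fun v => ⟨h.2, h.1 v⟩⟩, fun h => ⟨fun v => (h.2 v).2, h.1⟩⟩
      rw [this]
      refine isClosed_Icc.inter (isClosed_iInter fun v => ?_)
      refine ContinuousOn.preimage_isClosed_of_isClosed ?_ isClosed_Icc isClosed_Ici
      have h2 : Continuous fun N : Matrix ι ι ℝ => v ⬝ᵥ N *ᵥ v := by fun_prop
      exact h2.comp_continuousOn hcont
    · have h1 := Metric.continuousWithinAt_iff.1 (hcont t ⟨ht.1, ht.2.le⟩) (M⁻¹ / 2)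
        (by positivity)
      obtain ⟨δ, hδ, h1⟩ := h1
      have hlt : t < min (t + δ) T := lt_min (by linarith) ht.2
      refine Filter.mem_of_superset (Ioo_mem_nhdsGT hlt) fun s hs => ?_
      have hs0 : 0 ≤ s := ht.1.trans hs.1.le
      -- Just after `t`, continuity costs at most half of the lower bound `M⁻¹`. This suffices for
      -- definiteness on `[0, s]`, and the trace bound then restores the full `M⁻¹`.
      refine key _ ?_ ((hP.trace_inv_le hG hA hs0 ?_).trans (by linarith)) <;>
      have hpd : ∀ r ∈ Icc 0 s, (P r).PosDef := fun r hr => by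
        rcases le_or_gt r t with hrt | hrt
        · exact .of_mul_le (hsymm r hr.1) (inv_pos.2 hMpos) (hsub ⟨hr.1, hrt⟩)
        · have hsT := lt_min_iff.1 hs.2
          refine .of_mul_le (ε := M⁻¹ / 2) (hsymm r hr.1) (by positivity) fun v => ?_
          have h2 := h1 (x := r) ⟨hr.1, hr.2.trans hsT.2.le⟩ (by
            rw [Real.dist_eq, abs_of_pos (by linarith)]
            linarith [hr.2])
          rw [dist_comm, dist_eq_norm] at h2
          have h3 := dotProduct_mulVec_le_norm (P t - P r) v
          rw [sub_mulVec, dotProduct_sub] at h3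
          have h4 := hsub ⟨ht.1, le_rfl⟩ v
          have h5 := mul_le_mul_of_nonneg_right h2.le (dotProduct_self_real_nonneg v)
          linarith
      · exact hpd s ⟨hs0, le_rfl⟩
      · exact hpd
  exact .of_mul_le (hsymm T hT) (inv_pos.2 hMpos) (hS ⟨hT, le_rfl⟩)

/-- In the derivative of `tr(SP)`, the hypothesis on `SA` gives `-tr(SP) + b·tr(C'CP)`. The term
`-tr(SPC'CP) ≤ -c‖CP‖²` absorbs the positive contribution, which is only linear in `CP`. -/
theorem exists_trace_mul_le {S : Matrix ι ι ℝ} (hS : S.PosDef) {b : ℝ} (hb : 0 ≤ b)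
    (C : Matrix κ ι ℝ) (G : Matrix ι ι ℝ) :
    ∃ k, 0 ≤ k ∧ ∀ (A P : ℝ → Matrix ι ι ℝ), SolvesRiccati A C G P →
      (∀ t, 0 ≤ t → (P t).PosDef) →
      (∀ t, 0 ≤ t → ∀ v : ι → ℝ,
        2 * (v ⬝ᵥ (S * A t) *ᵥ v) ≤ -(v ⬝ᵥ S *ᵥ v) + b * ((C *ᵥ v) ⬝ᵥ (C *ᵥ v))) →
      ∀ t, 0 ≤ t → (S * P t).trace ≤ (S * P 0).trace + k := by
  obtain ⟨c, hc, hcS⟩ := hS.exists_pos_mul_le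
  have hSt : Sᵀ = S := by simpa using hS.isHermitian.eq
  refine ⟨|(S * (G * Gᵀ)).trace| + (b * ‖C‖) ^ 2 / c, by positivity,
    fun A P hP hpos hA T hT => ?_⟩
  have hSP : ∀ t, 0 ≤ t → 0 ≤ (S * P t).trace := fun t ht => by
    have := (hpos t ht).posSemidef.trace_mul_le (M := 0) (N := S) fun v => by
      simpa using hS.posSemidef.dotProduct_mulVec_nonneg v
    simpa using this
  refine ((hP.hasAEDerivOn hT).trace_mul_left hT S).le_add_of_deriv_le hT (hSP 0 le_rfl)
    (by positivity) fun t ht => ?_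
  have hPt := (hpos t ht.1.le).posSemidef
  have hPtt : (P t)ᵀ = P t := by simpa using hPt.isHermitian.eq
  have e1 : (S * (P t * (A t)ᵀ)).trace = (S * (A t * P t)).trace := by
    rw [← trace_transpose]
    simp only [transpose_mul, transpose_transpose, hSt, hPtt]
    rw [trace_mul_comm]
  have e2 : 2 * (S * (A t * P t)).trace ≤ -(S * P t).trace + b * (Cᵀ * (C * P t)).trace := by
    have := hPt.trace_mul_le (M := (2 : ℝ) • (S * A t)) (N := -S + b • (Cᵀ * C)) fun v => by
      simp only [smul_mulVec, dotProduct_smul, add_mulVec, neg_mulVec, dotProduct_add,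
        dotProduct_neg, smul_eq_mul, ← dotProduct_self_mulVec]
      exact hA t ht.1.le v
    simpa [Matrix.add_mul, Matrix.mul_assoc] using this
  have e3 : c * ‖C * P t‖ ^ 2 ≤ (S * (P t * Cᵀ * C * P t)).trace := by
    have h1 := (posSemidef_self_mul_conjTranspose (P t * Cᵀ)).trace_mul_le (M := c • 1) (N := S)
      fun v => by
        simp only [smul_mulVec, one_mulVec, dotProduct_smul, smul_eq_mul]
        exact hcS v
    simp only [conjTranspose_eq_transpose_of_trivial, transpose_mul, transpose_transpose, hPtt,
      smul_mul, one_mul, trace_smul, smul_eq_mul] at h1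
    rw [frobenius_norm_sq, transpose_mul, hPtt]
    simpa only [Matrix.mul_assoc] using h1
  have e4 := trace_transpose_mul_le C (C * P t)
  have e5 : (S * riccatiRHS (A t) C G (P t)).trace = (S * (A t * P t)).trace
      + (S * (P t * (A t)ᵀ)).trace + (S * (G * Gᵀ)).trace
      - (S * (P t * Cᵀ * C * P t)).trace := by
    simp only [riccatiRHS, Matrix.mul_add, Matrix.mul_sub, trace_add, trace_sub]
  -- Young's inequality, with a non-optimal constant.
  have e6 : b * ‖C‖ * ‖C * P t‖ ≤ c * ‖C * P t‖ ^ 2 + (b * ‖C‖) ^ 2 / c := by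
    have h1 : (b * ‖C‖) ^ 2 / c * c = (b * ‖C‖) ^ 2 := div_mul_cancel₀ _ hc.ne'
    have h2 : 0 ≤ (b * ‖C‖) ^ 2 / c := by positivity
    generalize (b * ‖C‖) ^ 2 / c = y at h1 h2 ⊢
    have h3 : 0 ≤ ‖C * P t‖ := norm_nonneg _
    have h4 : 0 ≤ b * ‖C‖ := by positivity
    generalize ‖C * P t‖ = r at *
    generalize b * ‖C‖ = x at *
    refine le_of_mul_le_mul_left ?_ hc
    nlinarith [sq_nonneg (x - 2 * c * r), sq_nonneg x]
  rw [e5, e1]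
  nlinarith [le_abs_self (S * (G * Gᵀ)).trace, mul_le_mul_of_nonneg_left e4 hb]

/-- Uniform bounds for the solutions of the Riccati equation and their inverses. -/
theorem exists_riccati_bounds {S : Matrix ι ι ℝ} (hS : S.PosDef) {b : ℝ} (hb : 0 ≤ b)
    (C : Matrix κ ι ℝ) {G : Matrix ι ι ℝ} (hG : IsUnit G) {P0 : Matrix ι ι ℝ} (hP0 : P0.PosDef)
    (a : ℝ) :
    ∃ m > 0, ∀ (A P : ℝ → Matrix ι ι ℝ), SolvesRiccati A C G P → P 0 = P0 →
      (∀ t, 0 ≤ t → ∀ i j, |A t i j| ≤ a) →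
      (∀ t, 0 ≤ t → ∀ v : ι → ℝ,
        2 * (v ⬝ᵥ (S * A t) *ᵥ v) ≤ -(v ⬝ᵥ S *ᵥ v) + b * ((C *ᵥ v) ⬝ᵥ (C *ᵥ v))) →
      ∀ t, 0 ≤ t → (P t).PosDef ∧ (P t).trace ≤ m ∧ (P t)⁻¹.trace ≤ m := by
  obtain ⟨k, hk, hub⟩ := exists_trace_mul_le hS hb C G
  obtain ⟨c, hc, hcS⟩ := hS.exists_pos_mul_le
  let a' := (Fintype.card ι : ℝ) * (Fintype.card ι * a)
  -- The first bound is for `P`, from `tr(SP)` and `S ≥ c`; the second is for `P⁻¹`.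
  refine ⟨max 1 (max ((S * P0).trace / c + k / c) (P0⁻¹.trace + infoBound a' C G)),
    by positivity, ?_⟩
  rintro A P hP rfl ha hA t ht
  have hA' : ∀ t, 0 ≤ t → ‖A t‖ ≤ a' := fun t ht => norm_le_of_entry_le (ha t ht)
  have hpos : ∀ t, 0 ≤ t → (P t).PosDef := fun t ht => hP.posDef hG hA' hP0 ht
  refine ⟨hpos t ht, le_max_of_le_right (le_max_of_le_left ?_),
    le_max_of_le_right (le_max_of_le_right ?_)⟩
  · have h1 := (hpos t ht).posSemidef.trace_mul_le (M := c • 1) (N := S) fun v => by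
      simp only [smul_mulVec, one_mulVec, dotProduct_smul, smul_eq_mul]
      exact hcS v
    simp only [smul_mul, one_mul, trace_smul, smul_eq_mul] at h1
    rw [← add_div, le_div_iff₀ hc, mul_comm]
    exact h1.trans (hub A P hP hpos hA t ht)
  · exact hP.trace_inv_le hG hA' ht fun s hs => hpos s hs.1

end Riccati

/-! ### Exponential decay of the estimation error. -/

section Lyapunov

open Matrix Set

/-- Bootstrap principle: by continuity, the strict inequality at the end of an interval extends the
weak one beyond it. -/
theorem forall_le_of_continuousOn_of_lt {φ : ℝ → ℝ} {c : ℝ}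
    (hφ : ∀ T, 0 ≤ T → ContinuousOn φ (Icc 0 T)) (h0 : φ 0 ≤ c)
    (h : ∀ T, 0 ≤ T → (∀ t ∈ Icc 0 T, φ t ≤ c) → φ T < c) : ∀ t, 0 ≤ t → φ t ≤ c := by
  intro T hT
  have : Icc 0 T ⊆ {t | φ t ≤ c} := by
    refine IsClosed.Icc_subset_of_forall_mem_nhdsGT_of_Icc_subset ?_ h0 fun t ht hsub => ?_
    · rw [inter_comm]
      exact (hφ T hT).preimage_isClosed_of_isClosed isClosed_Icc isClosed_Iic
    · have h1 := (hφ T hT t ⟨ht.1, ht.2.le⟩).eventually_lt_const (h t ht.1 hsub)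
      have h2 : Icc 0 T ∈ nhdsWithin t (Ioi t) :=
        Filter.mem_of_superset (Ioo_mem_nhdsGT ht.2) fun s hs => ⟨ht.1.trans hs.1.le, hs.2.le⟩
      have h3 := (h1.filter_mono (nhdsWithin_le_of_mem h2))
      exact h3.mono fun s hs => hs.le
  exact this ⟨hT, le_rfl⟩

attribute [local instance] Matrix.frobeniusNormedAddCommGroup Matrix.frobeniusNormedSpace
  Matrix.frobeniusNormedRing Matrix.frobeniusNormedAlgebra

variable {ι κ : Type*} [Fintype ι] [Fintype κ] [DecidableEq ι]

/-- The terms in `A` cancel, and the output injection contributes `-2|Ce|²`, of which the Riccati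
term `C'C` gives back one half. -/
theorem lyapunov_deriv_eq {A P G : Matrix ι ι ℝ} {C : Matrix κ ι ℝ} (hP : P.PosDef)
    (e r : ι → ℝ) :
    (-(P⁻¹ * riccatiRHS A C G P * P⁻¹) * vecMulVec e e
      + P⁻¹ * (vecMulVec (A *ᵥ e - (P * Cᵀ) *ᵥ (C *ᵥ e) + r) e
        + vecMulVec e (A *ᵥ e - (P * Cᵀ) *ᵥ (C *ᵥ e) + r))).trace
      = -((Gᵀ * P⁻¹) *ᵥ e) ⬝ᵥ ((Gᵀ * P⁻¹) *ᵥ e) - (C *ᵥ e) ⬝ᵥ (C *ᵥ e)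
        + 2 * ((P⁻¹ *ᵥ e) ⬝ᵥ r) := by
  have hu := (isUnit_iff_isUnit_det P).1 hP.isUnit
  have hQt : (P⁻¹)ᵀ = P⁻¹ := by simpa using hP.inv.isHermitian.eq
  rw [inv_mul_riccatiRHS_mul_inv hP.isUnit, Matrix.mul_add, trace_add, trace_add, Matrix.neg_mul,
    trace_neg, trace_mul_vecMulVec, trace_mul_vecMulVec, trace_mul_vecMulVec]
  have hs : ∀ x y : ι → ℝ, x ⬝ᵥ P⁻¹ *ᵥ y = (P⁻¹ *ᵥ x) ⬝ᵥ y := fun x y => by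
    rw [dotProduct_mulVec, ← mulVec_transpose, hQt]
  have hc : (P⁻¹ *ᵥ e) ⬝ᵥ ((P * Cᵀ) *ᵥ (C *ᵥ e)) = (C *ᵥ e) ⬝ᵥ (C *ᵥ e) := by
    rw [← hs, mulVec_mulVec, nonsing_inv_mul_cancel_left _ _ hu, dotProduct_mulVec,
      vecMul_transpose]
  have h1 : e ⬝ᵥ (P⁻¹ * G * Gᵀ * P⁻¹) *ᵥ e
      = ((Gᵀ * P⁻¹) *ᵥ e) ⬝ᵥ ((Gᵀ * P⁻¹) *ᵥ e) := by
    rw [dotProduct_self_mulVec, transpose_mul, transpose_transpose, hQt]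
    simp only [Matrix.mul_assoc]
  have h2 : e ⬝ᵥ (Aᵀ * P⁻¹) *ᵥ e = (P⁻¹ *ᵥ e) ⬝ᵥ (A *ᵥ e) := by
    rw [← mulVec_mulVec, dotProduct_mulVec, vecMul_transpose, dotProduct_comm]
  have h3 : e ⬝ᵥ (P⁻¹ * A) *ᵥ e = (P⁻¹ *ᵥ e) ⬝ᵥ (A *ᵥ e) := by
    rw [← mulVec_mulVec, hs]
  have h4 : ∀ x : ι → ℝ, x ⬝ᵥ P⁻¹ *ᵥ e = (P⁻¹ *ᵥ e) ⬝ᵥ x := fun x => dotProduct_comm _ _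
  rw [sub_mulVec, add_mulVec, add_mulVec, dotProduct_sub, dotProduct_add, dotProduct_add, h1, h2,
    h3, ← dotProduct_self_mulVec, hs e, h4, dotProduct_add, dotProduct_sub, hc, neg_dotProduct]
  ring

/-- With `V = e'P⁻¹e` and `g` the trace in the statement, `V ≤ m(g + 1)|G'P⁻¹e|²`, while `(P⁻¹e)·r ≤
mlρV`. The smallness of `ρ` lets the remainder use up at most half of the damping. -/
theorem lyapunov_deriv_le {P G : Matrix ι ι ℝ} (hP : P.PosDef) (hG : IsUnit G) {m l ρ : ℝ}
    (hm : 0 < m) (hl : 0 ≤ l) (hρ : 0 ≤ ρ) (hPm : P.trace ≤ m) (hQm : P⁻¹.trace ≤ m)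
    (hsmall : 4 * m ^ 2 * (((Gᵀ)⁻¹ᵀ * (Gᵀ)⁻¹).trace + 1) * l * ρ ≤ 1)
    {e r : ι → ℝ} (hr : r ⬝ᵥ r ≤ (l * (e ⬝ᵥ e)) ^ 2) (he : e ⬝ᵥ e ≤ ρ ^ 2) :
    -((Gᵀ * P⁻¹) *ᵥ e) ⬝ᵥ ((Gᵀ * P⁻¹) *ᵥ e) + 2 * ((P⁻¹ *ᵥ e) ⬝ᵥ r)
      ≤ -(1 / (2 * m * (((Gᵀ)⁻¹ᵀ * (Gᵀ)⁻¹).trace + 1))) * (e ⬝ᵥ P⁻¹ *ᵥ e) := by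
  have hu := (isUnit_iff_isUnit_det P).1 hP.isUnit
  have huG : IsUnit (Gᵀ).det := by
    rw [det_transpose]; exact (isUnit_iff_isUnit_det G).1 hG
  have hV0 : 0 ≤ e ⬝ᵥ P⁻¹ *ᵥ e := by simpa using hP.inv.posSemidef.dotProduct_mulVec_nonneg e
  have hg0 : 0 ≤ ((Gᵀ)⁻¹ᵀ * (Gᵀ)⁻¹).trace := by
    simpa using (posSemidef_conjTranspose_mul_self (Gᵀ)⁻¹).trace_nonneg
  have h1 : (P⁻¹ *ᵥ e) ⬝ᵥ (P⁻¹ *ᵥ e) ≤ (((Gᵀ)⁻¹ᵀ * (Gᵀ)⁻¹).trace + 1) *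
      (((Gᵀ * P⁻¹) *ᵥ e) ⬝ᵥ ((Gᵀ * P⁻¹) *ᵥ e)) := by
    have h2 := (posSemidef_conjTranspose_mul_self (Gᵀ)⁻¹).dotProduct_mulVec_le
      ((Gᵀ * P⁻¹) *ᵥ e)
    rw [conjTranspose_eq_transpose_of_trivial, ← dotProduct_self_mulVec, mulVec_mulVec,
      nonsing_inv_mul_cancel_left _ _ huG] at h2
    linarith [dotProduct_self_real_nonneg ((Gᵀ * P⁻¹) *ᵥ e)]
  have h2 : e ⬝ᵥ P⁻¹ *ᵥ e ≤ m * ((P⁻¹ *ᵥ e) ⬝ᵥ (P⁻¹ *ᵥ e)) := by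
    have h3 := hP.posSemidef.dotProduct_mulVec_le (P⁻¹ *ᵥ e)
    rw [mulVec_mulVec, mul_nonsing_inv _ hu, one_mulVec, dotProduct_comm] at h3
    exact h3.trans (mul_le_mul_of_nonneg_right hPm (dotProduct_self_real_nonneg _))
  have h3 : (P⁻¹ *ᵥ e) ⬝ᵥ (P⁻¹ *ᵥ e) ≤ m * (e ⬝ᵥ P⁻¹ *ᵥ e) :=
    (hP.inv.posSemidef.mulVec_dotProduct_self_le e).trans (mul_le_mul_of_nonneg_right hQm hV0)
  have h4 : e ⬝ᵥ e ≤ m * (e ⬝ᵥ P⁻¹ *ᵥ e) :=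
    (hP.dotProduct_self_le_inv e).trans (mul_le_mul_of_nonneg_right hPm hV0)
  have h5 := sq_dotProduct_le (P⁻¹ *ᵥ e) r
  have he0 := dotProduct_self_real_nonneg e
  have hr0 := dotProduct_self_real_nonneg r
  generalize hV : e ⬝ᵥ P⁻¹ *ᵥ e = V at *
  generalize (P⁻¹ *ᵥ e) ⬝ᵥ r = y at *
  have h6 : y ≤ m * l * ρ * V := by
    refine le_of_sq_le_sq ?_ (by positivity)
    calc y ^ 2 ≤ (m * V) * (l * (e ⬝ᵥ e)) ^ 2 :=
          h5.trans (mul_le_mul h3 hr hr0 (by positivity))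
      _ = (m * V) * l ^ 2 * ((e ⬝ᵥ e) * (e ⬝ᵥ e)) := by ring
      _ ≤ (m * V) * l ^ 2 * (ρ ^ 2 * (m * V)) := by gcongr
      _ = (m * l * ρ * V) ^ 2 := by ring
  generalize ((Gᵀ)⁻¹ᵀ * (Gᵀ)⁻¹).trace = g at *
  rw [neg_dotProduct]
  generalize ((Gᵀ * P⁻¹) *ᵥ e) ⬝ᵥ ((Gᵀ * P⁻¹) *ᵥ e) = W at *
  have h7 : V ≤ m * (g + 1) * W := by
    rw [mul_assoc]
    exact h2.trans (mul_le_mul_of_nonneg_left h1 hm.le)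
  have hmg : 0 < 2 * m * (g + 1) := by positivity
  refine le_of_mul_le_mul_left ?_ hmg
  have h8 : 2 * m * (g + 1) * (-(1 / (2 * m * (g + 1))) * V) = -V := by
    field_simp
  rw [h8]
  have h9 := mul_le_mul_of_nonneg_left h6 hmg.le
  have h10 := mul_le_mul_of_nonneg_right hsmall hV0
  nlinarith

/-- Local exponential stability of the estimation error of the extended Kalman filter, given uniform
bounds for the solution of the Riccati equation and a quadratic bound for the remainder. -/
theorem exists_exp_decay {G : Matrix ι ι ℝ} (hG : IsUnit G) (C : Matrix κ ι ℝ) {m l : ℝ}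
    (hm : 0 < m) (hl : 0 ≤ l) :
    ∃ δ > 0, ∃ α > 0, ∀ (A P : ℝ → Matrix ι ι ℝ) (e r : ℝ → ι → ℝ), SolvesRiccati A C G P →
      (∀ t, 0 ≤ t → (P t).PosDef ∧ (P t).trace ≤ m ∧ (P t)⁻¹.trace ≤ m) →
      (∀ i, SolvesODE (fun t => e t i)
        (fun t => (A t *ᵥ e t - (P t * Cᵀ) *ᵥ (C *ᵥ e t) + r t) i)) →
      (∀ t, 0 ≤ t → r t ⬝ᵥ r t ≤ (l * (e t ⬝ᵥ e t)) ^ 2) →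
      e 0 ⬝ᵥ e 0 < δ ^ 2 →
      ∀ t, 0 ≤ t → e t ⬝ᵥ e t ≤ m ^ 2 * Real.exp (-(α * t)) * (e 0 ⬝ᵥ e 0) := by
  have hg0 : 0 ≤ ((Gᵀ)⁻¹ᵀ * (Gᵀ)⁻¹).trace := by
    simpa using (posSemidef_conjTranspose_mul_self (Gᵀ)⁻¹).trace_nonneg
  set g := ((Gᵀ)⁻¹ᵀ * (Gᵀ)⁻¹).trace with hg
  set q := 4 * m ^ 2 * (g + 1) * l with hq
  have hq0 : 0 ≤ q := by positivity
  set ρ := (q + 1)⁻¹ with hρ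
  have hρ0 : 0 < ρ := by positivity
  have hsmall : q * ρ ≤ 1 := by
    rw [hρ, ← div_eq_mul_inv, div_le_one (by positivity)]; linarith
  -- Passing between `|e|²` and `V` costs a factor `m` each way, so starting within `ρ / m` keeps
  -- the error within the radius `ρ` where the decay estimate is valid.
  refine ⟨ρ / m, by positivity, 1 / (2 * m * (g + 1)), by positivity,
    fun A P e r hP hPm he hr h0 => ?_⟩
  set α := 1 / (2 * m * (g + 1)) with hα
  have hV1 : ∀ t, 0 ≤ t → e t ⬝ᵥ e t ≤ m * (e t ⬝ᵥ (P t)⁻¹ *ᵥ e t) := fun t ht => by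
    obtain ⟨h1, h2, -⟩ := hPm t ht
    exact (h1.dotProduct_self_le_inv _).trans (mul_le_mul_of_nonneg_right h2 (by
      simpa using h1.inv.posSemidef.dotProduct_mulVec_nonneg (e t)))
  have hV2 : ∀ t, 0 ≤ t → e t ⬝ᵥ (P t)⁻¹ *ᵥ e t ≤ m * (e t ⬝ᵥ e t) := fun t ht => by
    obtain ⟨h1, -, h2⟩ := hPm t ht
    exact (h1.inv.posSemidef.dotProduct_mulVec_le _).trans
      (mul_le_mul_of_nonneg_right h2 (dotProduct_self_real_nonneg _))
  have key : ∀ T, 0 ≤ T → (∀ t ∈ Icc 0 T, e t ⬝ᵥ e t ≤ ρ ^ 2) →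
      e T ⬝ᵥ e T ≤ m ^ 2 * Real.exp (-(α * T)) * (e 0 ⬝ᵥ e 0) := by
    intro T hT hsub
    let F : ℝ → ι → ℝ := fun t => A t *ᵥ e t - (P t * Cᵀ) *ᵥ (C *ᵥ e t) + r t
    have hX : HasAEDerivOn (fun t => vecMulVec (e t) (e t))
        (fun t => vecMulVec (F t) (e t) + vecMulVec (e t) (F t)) T :=
      .matrix hT fun i j => ((he i).hasAEDerivOn hT).mul ((he j).hasAEDerivOn hT)
    have h1 := (hP.hasAEDerivOn hT).trace_inv_mul hT hX fun t ht => (hPm t ht.1).1.isUnit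
    have h2 := h1.le_exp_mul (c := -α) hT fun t ht => by
      obtain ⟨k1, k2, k3⟩ := hPm t ht.1.le
      rw [lyapunov_deriv_eq k1, trace_mul_vecMulVec]
      have := lyapunov_deriv_le k1 hG hm hl hρ0.le k2 k3 hsmall (hr t ht.1.le)
        (hsub t ⟨ht.1.le, ht.2.le⟩)
      linarith [dotProduct_self_real_nonneg (C *ᵥ e t)]
    rw [trace_mul_vecMulVec, trace_mul_vecMulVec, neg_mul] at h2
    calc e T ⬝ᵥ e T ≤ m * (Real.exp (-(α * T)) * (m * (e 0 ⬝ᵥ e 0))) := by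
          refine (hV1 T hT).trans (mul_le_mul_of_nonneg_left (h2.trans ?_) hm.le)
          exact mul_le_mul_of_nonneg_left (hV2 0 le_rfl) (Real.exp_pos _).le
      _ = _ := by ring
  have h0' : m ^ 2 * (e 0 ⬝ᵥ e 0) < ρ ^ 2 := by
    rw [div_pow, lt_div_iff₀ (by positivity)] at h0
    linarith
  have hα0 : 0 < α := by positivity
  have hbound : ∀ t, 0 ≤ t → e t ⬝ᵥ e t ≤ ρ ^ 2 := by
    refine forall_le_of_continuousOn_of_lt (fun T hT => ?_) ?_ fun T hT hsub => ?_
    · exact continuousOn_finsetSum _ fun i _ =>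
        (((he i).hasAEDerivOn hT).continuousOn hT).mul (((he i).hasAEDerivOn hT).continuousOn hT)
    · have := hV1 0 le_rfl
      have := mul_le_mul_of_nonneg_left (hV2 0 le_rfl) hm.le
      nlinarith
    · refine (key T hT hsub).trans_lt (lt_of_le_of_lt ?_ h0')
      refine mul_le_mul_of_nonneg_right ?_ (dotProduct_self_real_nonneg _)
      refine mul_le_of_le_one_right (by positivity) (Real.exp_le_one_iff.2 ?_)
      nlinarith
  exact fun t ht => key t ht fun s hs => hbound s hs.1

end Lyapunov

/-! ### Observability Gramian and high-gain scaling. -/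

section HighGain

open Matrix Set

attribute [local instance] Matrix.frobeniusNormedAddCommGroup Matrix.frobeniusNormedSpace
  Matrix.frobeniusNormedRing Matrix.frobeniusNormedAlgebra

variable {p : ℕ} {l : Fin p → ℕ}

/-- The row vector `C̄ᵢ exp(t Ā)`. -/
noncomputable def outputFlow (l : Fin p → ℕ) (i : Fin p) (t : ℝ) : Idx l → ℝ :=
  fun r => if r.1 = i then t ^ r.2.val / (r.2.val.factorial : ℝ) else 0

theorem continuous_outputFlow (i : Fin p) (r : Idx l) :
    Continuous fun t => outputFlow l i t r := by
  unfold outputFlow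
  split_ifs <;> fun_prop

theorem outputFlow_zero_dotProduct (i : Fin p) (v : Idx l → ℝ) :
    outputFlow l i 0 ⬝ᵥ v = (Cbar l *ᵥ v) i := by
  refine Finset.sum_congr rfl fun r _ => ?_
  simp only [outputFlow, Cbar, of_apply, eq_comm (a := i)]
  rcases Nat.eq_zero_or_pos r.2.val with h | h
  · simp [h]
  · simp [h.ne']

theorem hasDerivAt_outputFlow (i : Fin p) (r : Idx l) (t : ℝ) :
    HasDerivAt (fun s => outputFlow l i s r) ((outputFlow l i t ᵥ* Abar l) r) t := by
  obtain ⟨a, ⟨k, hk⟩⟩ := r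
  by_cases ha : a = i
  · subst ha
    rcases k with _ | k
    · have h0 : (outputFlow l a t ᵥ* Abar l) ⟨a, ⟨0, hk⟩⟩ = 0 := by
        simp [vecMul, dotProduct, Abar]
      rw [h0]
      simpa [outputFlow] using hasDerivAt_const t (1 : ℝ)
    · have h0 : (outputFlow l a t ᵥ* Abar l) ⟨a, ⟨k + 1, hk⟩⟩
          = t ^ k / (k.factorial : ℝ) := by
        simp only [vecMul, dotProduct]
        rw [Finset.sum_eq_single ⟨a, ⟨k, by omega⟩⟩]
        · simp [outputFlow, Abar]
        · rintro ⟨b, ⟨j, hj⟩⟩ - hne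
          simp only [Abar, of_apply, mul_ite, mul_one, mul_zero, ite_eq_right_iff, and_imp]
          rintro rfl hjk
          exact absurd (by obtain rfl : j = k := by omega
                           rfl) hne
        · simp
      rw [h0]
      simp only [outputFlow, if_true]
      refine ((hasDerivAt_pow (k + 1) t).div_const ((k + 1).factorial : ℝ)).congr_deriv ?_
      rw [Nat.factorial_succ, Nat.add_sub_cancel]
      push_cast
      field_simp
  · have h0 : (outputFlow l i t ᵥ* Abar l) ⟨a, ⟨k, hk⟩⟩ = 0 := by
      refine Finset.sum_eq_zero fun s _ => ?_
      simp only [outputFlow, Abar, of_apply]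
      by_cases hs : s.1 = i
      · have : s.1 ≠ a := fun h => ha (h.symm.trans hs)
        simp [this]
      · simp [hs]
    rw [h0]
    simpa [outputFlow, ha] using hasDerivAt_const t (0 : ℝ)

theorem hasDerivAt_outputFlow_dotProduct (i : Fin p) (v : Idx l → ℝ) (t : ℝ) :
    HasDerivAt (fun s => outputFlow l i s ⬝ᵥ v) (outputFlow l i t ⬝ᵥ Abar l *ᵥ v) t := by
  rw [dotProduct_mulVec]
  exact HasDerivAt.fun_sum fun r _ => (hasDerivAt_outputFlow i r t).mul_const (v r)

theorem continuous_outputFlow_dotProduct (i : Fin p) (v : Idx l → ℝ) :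
    Continuous fun t => outputFlow l i t ⬝ᵥ v :=
  continuous_finsetSum _ fun r _ => (continuous_outputFlow i r).mul continuous_const

/-- Observability of `(Ā, C̄)`: each output is a polynomial in `t` whose coefficients are, up to
factorials, the coordinates of its block. If it vanishes on an interval, so do they. -/
theorem exists_outputFlow_dotProduct_ne_zero {v : Idx l → ℝ} (hv : v ≠ 0) :
    ∃ i, ∃ t ∈ Icc (-1 : ℝ) 0, outputFlow l i t ⬝ᵥ v ≠ 0 := by
  by_contra! h
  refine hv (funext fun ⟨i, k⟩ => ?_)
  let q : Polynomial ℝ := ∑ r : Idx l,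
    if r.1 = i then Polynomial.monomial r.2.val (v r / (r.2.val.factorial : ℝ)) else 0
  have heval : ∀ t, q.eval t = outputFlow l i t ⬝ᵥ v := fun t => by
    simp only [q, Polynomial.eval_finsetSum, dotProduct, outputFlow]
    refine Finset.sum_congr rfl fun r _ => ?_
    split_ifs
    · rw [Polynomial.eval_monomial]; ring
    · simp
  have hq : q = 0 := Polynomial.eq_zero_of_infinite_isRoot q
    ((Icc_infinite (by norm_num : (-1 : ℝ) < 0)).mono fun t ht => (heval t).trans (h i t ht))
  have hcoeff : q.coeff k.val = v ⟨i, k⟩ / (k.val.factorial : ℝ) := by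
    simp only [q, Polynomial.finsetSum_coeff]
    rw [Finset.sum_eq_single ⟨i, k⟩]
    · simp
    · rintro ⟨b, j⟩ - hne
      split_ifs with hb
      · obtain rfl : b = i := hb
        rw [Polynomial.coeff_monomial, if_neg]
        exact fun hjk => hne (by rw [show j = k from Fin.ext hjk])
      · simp
    · simp
  rw [hq, Polynomial.coeff_zero, eq_comm, div_eq_zero_iff] at hcoeff
  exact hcoeff.resolve_right (by positivity)

/-- The exponentially weighted observability Gramian of `(Ā, C̄)` over a unit interval of the
past. -/
noncomputable def pastGramian (l : Fin p → ℕ) : Matrix (Idx l) (Idx l) ℝ :=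
  of fun s r => ∑ i, ∫ t in (-1 : ℝ)..0, Real.exp t * (outputFlow l i t s * outputFlow l i t r)

theorem dotProduct_pastGramian_mulVec (v w : Idx l → ℝ) :
    v ⬝ᵥ pastGramian l *ᵥ w = ∑ i, ∫ t in (-1 : ℝ)..0,
      Real.exp t * ((outputFlow l i t ⬝ᵥ v) * (outputFlow l i t ⬝ᵥ w)) := by
  have h1 : ∀ i t, Real.exp t * ((outputFlow l i t ⬝ᵥ v) * (outputFlow l i t ⬝ᵥ w))
      = ∑ s, ∑ r, v s * ((Real.exp t * (outputFlow l i t s * outputFlow l i t r)) * w r) := by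
    intro i t
    simp only [dotProduct]
    rw [Finset.sum_mul_sum, Finset.mul_sum]
    refine Finset.sum_congr rfl fun s _ => ?_
    rw [Finset.mul_sum]
    exact Finset.sum_congr rfl fun r _ => by ring
  have hc : ∀ i s r, Continuous fun t =>
      v s * ((Real.exp t * (outputFlow l i t s * outputFlow l i t r)) * w r) := fun i s r => by
    have := continuous_outputFlow i s
    have := continuous_outputFlow i r
    fun_prop
  have h2 : ∀ i, ∫ t in (-1 : ℝ)..0,
      Real.exp t * ((outputFlow l i t ⬝ᵥ v) * (outputFlow l i t ⬝ᵥ w))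
      = ∑ s, ∑ r, v s * ((∫ t in (-1 : ℝ)..0,
        Real.exp t * (outputFlow l i t s * outputFlow l i t r)) * w r) := by
    intro i
    simp only [h1]
    rw [intervalIntegral.integral_finsetSum fun s _ =>
      (continuous_finsetSum _ fun r _ => hc i s r).intervalIntegrable _ _]
    refine Finset.sum_congr rfl fun s _ => ?_
    rw [intervalIntegral.integral_finsetSum fun r _ => (hc i s r).intervalIntegrable _ _]
    refine Finset.sum_congr rfl fun r _ => ?_
    rw [intervalIntegral.integral_const_mul, intervalIntegral.integral_mul_const]
  rw [Finset.sum_congr rfl fun i _ => h2 i, Finset.sum_comm]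
  simp only [dotProduct, mulVec]
  refine Finset.sum_congr rfl fun s _ => ?_
  rw [Finset.sum_comm, Finset.mul_sum]
  refine Finset.sum_congr rfl fun r _ => ?_
  rw [pastGramian, of_apply, Finset.sum_mul, Finset.mul_sum]

theorem posDef_pastGramian : (pastGramian l).PosDef := by
  refine .of_dotProduct_mulVec_pos ?_ fun v hv => ?_
  · ext s r
    simp [pastGramian, mul_comm]
  · rw [star_trivial, dotProduct_pastGramian_mulVec]
    obtain ⟨i, t, ht, hne⟩ := exists_outputFlow_dotProduct_ne_zero hv
    have hc : ∀ j, Continuous fun t =>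
        Real.exp t * ((outputFlow l j t ⬝ᵥ v) * (outputFlow l j t ⬝ᵥ v)) := fun j => by
      have := continuous_outputFlow_dotProduct j v
      fun_prop
    have hn : ∀ j t, 0 ≤ Real.exp t * ((outputFlow l j t ⬝ᵥ v) * (outputFlow l j t ⬝ᵥ v)) :=
      fun j t => mul_nonneg (Real.exp_pos t).le (mul_self_nonneg _)
    refine Finset.sum_pos' (fun j _ => intervalIntegral.integral_nonneg (by norm_num)
      fun t _ => hn j t) ⟨i, Finset.mem_univ i, ?_⟩
    exact intervalIntegral.integral_pos (by norm_num) (hc i).continuousOn (fun t _ => hn i t)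
      ⟨t, ht, mul_pos (Real.exp_pos t) (mul_self_pos.2 hne)⟩

/-- Integrating the derivative of `eᵗ(C̄ᵢ exp(tĀ)v)²` over `[-1, 0]` gives the boundary value
`(C̄v)ᵢ²` at `0` minus a nonnegative one at `-1`. The weight `eᵗ` produces the term `-S`. -/
theorem two_mul_pastGramian_mul_Abar_le (v : Idx l → ℝ) :
    2 * (v ⬝ᵥ (pastGramian l * Abar l) *ᵥ v)
      ≤ -(v ⬝ᵥ pastGramian l *ᵥ v) + (Cbar l *ᵥ v) ⬝ᵥ (Cbar l *ᵥ v) := by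
  rw [← mulVec_mulVec, dotProduct_pastGramian_mulVec, dotProduct_pastGramian_mulVec,
    Finset.mul_sum, ← Finset.sum_neg_distrib, dotProduct, ← Finset.sum_add_distrib]
  refine Finset.sum_le_sum fun i _ => ?_
  have hv := continuous_outputFlow_dotProduct i v
  have hAv := continuous_outputFlow_dotProduct i (Abar l *ᵥ v)
  have hd : ∀ t, HasDerivAt
      (fun s => Real.exp s * ((outputFlow l i s ⬝ᵥ v) * (outputFlow l i s ⬝ᵥ v)))
      (Real.exp t * ((outputFlow l i t ⬝ᵥ v) * (outputFlow l i t ⬝ᵥ v))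
        + 2 * (Real.exp t * ((outputFlow l i t ⬝ᵥ v) * (outputFlow l i t ⬝ᵥ Abar l *ᵥ v)))) t := by
    intro t
    have h1 := hasDerivAt_outputFlow_dotProduct i v t
    exact ((Real.hasDerivAt_exp t).fun_mul (h1.fun_mul h1)).congr_deriv (by ring)
  have h2 := intervalIntegral.integral_eq_sub_of_hasDerivAt (a := -1) (b := 0)
    (fun t _ => hd t) (Continuous.intervalIntegrable (by fun_prop) _ _)
  rw [intervalIntegral.integral_add (Continuous.intervalIntegrable (by fun_prop) _ _)
    (Continuous.intervalIntegrable (by fun_prop) _ _), intervalIntegral.integral_const_mul] at h2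
  simp only [Real.exp_zero, one_mul, outputFlow_zero_dotProduct] at h2
  have h3 := mul_nonneg (Real.exp_pos (-1)).le (mul_self_nonneg (outputFlow l i (-1) ⬝ᵥ v))
  linarith

/-- A quadratic Lyapunov function for the high-gain observer, valid for all perturbations of `Ā`
by bounded matrices with the triangular structure of `∂f̄/∂x`. -/
theorem exists_highGain (l : Fin p → ℕ) (L : ℝ) :
    ∃ S : Matrix (Idx l) (Idx l) ℝ, S.PosDef ∧ ∃ b ≥ 0, ∀ J : Matrix (Idx l) (Idx l) ℝ,
      (∀ s r, |J s r| ≤ L) → (∀ s r : Idx l, s.2.val < r.2.val → J s r = 0) →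
      ∀ v : Idx l → ℝ, 2 * (v ⬝ᵥ (S * (Abar l + J)) *ᵥ v)
        ≤ -(v ⬝ᵥ S *ᵥ v) + b * ((Cbar l *ᵥ v) ⬝ᵥ (Cbar l *ᵥ v)) := by
  have hS0 := posDef_pastGramian (l := l)
  have hmain := two_mul_pastGramian_mul_Abar_le (l := l)
  set S0 := pastGramian l with hS0def
  obtain ⟨c, hc, hcS⟩ := hS0.exists_pos_mul_le
  let a : ℝ := Fintype.card (Idx l) * (Fintype.card (Idx l) * |L|)
  have ha : 0 ≤ a := by positivity
  -- The excess of `θ` over `1` pays for the perturbation, whose contribution is at most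
  -- `2‖S0‖a|w|²`; the `1` leaves the required `-S`.
  let θ : ℝ := 1 + 2 * (‖S0‖ * a) / c
  have hθ : 1 ≤ θ := by
    have : 0 ≤ 2 * (‖S0‖ * a) / c := by positivity
    simp only [θ]; linarith
  have hθ0 : 0 < θ := by linarith
  let D : Matrix (Idx l) (Idx l) ℝ := diagonal fun r => θ⁻¹ ^ r.2.val
  have hDt : Dᵀ = D := diagonal_transpose _
  have hS : ∀ x y : Idx l → ℝ, x ⬝ᵥ (D * S0 * D) *ᵥ y = (D *ᵥ x) ⬝ᵥ S0 *ᵥ (D *ᵥ y) := by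
    intro x y
    rw [mulVec_mulVec, Matrix.mul_assoc, ← mulVec_mulVec, dotProduct_mulVec, ← mulVec_transpose,
      hDt]
  have hDu : IsUnit D := by
    rw [isUnit_iff_isUnit_det, det_diagonal]
    exact (Finset.prod_ne_zero_iff.2 fun r _ => by positivity).isUnit
  refine ⟨D * S0 * D, ?_, θ, hθ0.le, fun J hJ hJ0 v => ?_⟩
  · have := hS0.conjTranspose_mul_mul_same (B := D)
      (mulVec_injective_of_isUnit hDu)
    rwa [conjTranspose_eq_transpose_of_trivial, hDt] at this
  -- `J' = DJD⁻¹`. The truncated subtraction is harmless: where it truncates, `J` vanishes, and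
  -- elsewhere the factor is at most `1` because `θ ≥ 1`.
  · let J' : Matrix (Idx l) (Idx l) ℝ := of fun s r => θ⁻¹ ^ (s.2.val - r.2.val) * J s r
    have hDA : D * Abar l = θ • (Abar l * D) := by
      ext s r
      simp only [D, diagonal_mul, mul_diagonal, Matrix.smul_apply, Abar, of_apply, smul_eq_mul]
      split_ifs with h
      · rw [← h.2, pow_succ]
        field_simp
      · simp
    have hDJ : D * J = J' * D := by
      ext s r
      simp only [D, J', diagonal_mul, mul_diagonal, of_apply]
      rcases lt_or_ge s.2.val r.2.val with h | h
      · simp [hJ0 s r h]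
      · rw [mul_right_comm, ← pow_add, Nat.sub_add_cancel h]
    have hDC : Cbar l * D = Cbar l := by
      ext s r
      simp only [D, mul_diagonal, Cbar, of_apply]
      split_ifs with h
      · simp [h.2]
      · simp
    have hJ' : ‖J'‖ ≤ a := norm_le_of_entry_le fun s r => by
      simp only [J', of_apply, abs_mul]
      have h1 : |θ⁻¹ ^ (s.2.val - r.2.val)| ≤ 1 := by
        rw [abs_of_nonneg (by positivity)]
        exact pow_le_one₀ (by positivity) (inv_le_one_of_one_le₀ hθ)
      exact (mul_le_of_le_one_left (abs_nonneg _) h1).trans ((hJ s r).trans (le_abs_self L))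
    set w := D *ᵥ v with hw
    have e1 : v ⬝ᵥ (D * S0 * D * (Abar l + J)) *ᵥ v
        = θ * (w ⬝ᵥ (S0 * Abar l) *ᵥ w) + w ⬝ᵥ (S0 * J') *ᵥ w := by
      have h1 : D *ᵥ ((Abar l + J) *ᵥ v) = θ • (Abar l *ᵥ w) + J' *ᵥ w := by
        rw [mulVec_mulVec, Matrix.mul_add, hDA, hDJ, add_mulVec, smul_mulVec, ← mulVec_mulVec,
          ← mulVec_mulVec]
      rw [← mulVec_mulVec, hS, h1, mulVec_add, mulVec_smul, dotProduct_add, dotProduct_smul,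
        mulVec_mulVec w S0, mulVec_mulVec w S0, smul_eq_mul]
    have e2 : Cbar l *ᵥ v = Cbar l *ᵥ w := by rw [hw, mulVec_mulVec, hDC]
    rw [e1, e2, hS, ← hw]
    have h1 := hmain w
    have h2 := dotProduct_mulVec_le_norm (S0 * J') w
    have h3 : ‖S0 * J'‖ ≤ ‖S0‖ * a :=
      (frobenius_norm_mul _ _).trans (mul_le_mul_of_nonneg_left hJ' (norm_nonneg _))
    have h4 := mul_le_mul_of_nonneg_right h3 (dotProduct_self_real_nonneg w)
    have h5 : 2 * (‖S0‖ * a * (w ⬝ᵥ w)) ≤ 2 * (‖S0‖ * a) / c * (w ⬝ᵥ S0 *ᵥ w) := by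
      have := mul_le_mul_of_nonneg_left (hcS w) (by positivity : 0 ≤ 2 * (‖S0‖ * a) / c)
      refine le_trans (le_of_eq ?_) this
      field_simp
    have h6 := mul_le_mul_of_nonneg_left h1 hθ0.le
    have h7 : θ * (w ⬝ᵥ S0 *ᵥ w) = w ⬝ᵥ S0 *ᵥ w + 2 * (‖S0‖ * a) / c * (w ⬝ᵥ S0 *ᵥ w) := by
      simp only [θ]; ring
    linarith

end HighGain

/-! ### Taylor remainder and Jacobians. -/

section Linearization

open Matrix Set

/-- The mean value inequality is used twice along the segment from `x` to `x + e`. Both directions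
of the second derivative are `e`, so a bound on its diagonal suffices; the factor `1/2` is given up.
-/
theorem norm_sub_fderiv_le_of_norm_hessian_le {E F : Type*} [NormedAddCommGroup E]
    [NormedSpace ℝ E] [NormedAddCommGroup F] [NormedSpace ℝ F] {g : E → F} (hg : ContDiff ℝ 2 g)
    {L : ℝ} (h : ∀ x ξ : E, ‖iteratedFDeriv ℝ 2 g x ![ξ, ξ]‖ ≤ L * ‖ξ‖ ^ 2) (x e : E) :
    ‖g (x + e) - g x - fderiv ℝ g x e‖ ≤ L * ‖e‖ ^ 2 := by
  have hC : 0 ≤ L * ‖e‖ ^ 2 := (norm_nonneg _).trans (h x e)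
  have hγ : ∀ t : ℝ, HasDerivAt (fun s : ℝ => x + s • e) e t := fun t => by
    simpa using ((hasDerivAt_id t).smul_const e).const_add x
  have hd1 : ∀ z, HasFDerivAt g (fderiv ℝ g z) z := fun z =>
    (hg.differentiable (by norm_num) z).hasFDerivAt
  have hd2 : ∀ z, HasFDerivAt (fderiv ℝ g) (fderiv ℝ (fderiv ℝ g) z) z := fun z =>
    ((hg.fderiv_right (m := 1) (by norm_num)).differentiable (by norm_num) z).hasFDerivAt
  have h1 : ∀ t : ℝ, HasDerivAt (fun s : ℝ => fderiv ℝ g (x + s • e) e)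
      (fderiv ℝ (fderiv ℝ g) (x + t • e) e e) t := fun t => by
    simpa using ((hd2 _).comp_hasDerivAt t (hγ t)).clm_apply (hasDerivAt_const t e)
  have h2 : ∀ t : ℝ, HasDerivAt (fun s : ℝ => g (x + s • e)) (fderiv ℝ g (x + t • e) e) t :=
    fun t => (hd1 _).comp_hasDerivAt t (hγ t)
  have h3 : ∀ t ∈ Icc (0 : ℝ) 1, ‖fderiv ℝ g (x + t • e) e - fderiv ℝ g x e‖ ≤ L * ‖e‖ ^ 2 := by
    intro t ht
    have h4 := norm_image_sub_le_of_norm_deriv_le_segment' (C := L * ‖e‖ ^ 2)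
      (fun t _ => (h1 t).hasDerivWithinAt) (fun s _ => by
        have := h (x + s • e) e
        rwa [iteratedFDeriv_two_apply] at this) t ht
    simp only [zero_smul, add_zero, sub_zero] at h4
    exact h4.trans (mul_le_of_le_one_right hC ht.2)
  have h5 := norm_image_sub_le_of_norm_deriv_le_segment_01' (C := L * ‖e‖ ^ 2)
    (f := fun s : ℝ => g (x + s • e) - s • fderiv ℝ g x e)
    (fun t _ => ((h2 t).sub ((hasDerivAt_id t).smul_const _)).hasDerivWithinAt)
    (fun t ht => by simpa using h3 t ⟨ht.1, ht.2.le⟩)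
  simpa [sub_right_comm] using h5

variable {ι κ : Type} [Fintype ι] [Fintype κ]

theorem norm_sq_eq_dotProduct (x : Vec ι) : ‖x‖ ^ 2 = x.ofLp ⬝ᵥ x.ofLp := by
  rw [EuclideanSpace.norm_sq_eq]
  simp [dotProduct, ← sq]

variable [DecidableEq ι]

theorem jacobian_mulVec (g : Vec ι → Vec κ) (x v : Vec ι) :
    jacobian g x *ᵥ v.ofLp = (fderiv ℝ g x v).ofLp := by
  have hv : v = ∑ i, v i • EuclideanSpace.single i (1 : ℝ) := by
    ext j
    simp [Pi.single_apply]
  ext k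
  conv_rhs => rw [hv]
  simp [map_sum, jacobian, mulVec, dotProduct, mul_comm]

theorem hasFDerivAt_toLp_mulVec (M : Matrix κ ι ℝ) (x : Vec ι) :
    HasFDerivAt (fun z : Vec ι => (WithLp.toLp 2 (M *ᵥ z.ofLp) : Vec κ))
      (LinearMap.toContinuousLinearMap (Matrix.toLpLin 2 2 M)) x :=
  (LinearMap.toContinuousLinearMap (Matrix.toLpLin 2 2 M)).hasFDerivAt

theorem jacobian_toLp_mulVec_add {M : Matrix κ ι ℝ} {g : Vec ι → Vec κ} {x : Vec ι}
    (hg : DifferentiableAt ℝ g x) :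
    jacobian (fun z => WithLp.toLp 2 (M *ᵥ z.ofLp) + g z) x = M + jacobian g x := by
  ext k i
  have h := ((hasFDerivAt_toLp_mulVec M x).add hg.hasFDerivAt).fderiv
  simp only [jacobian, of_apply, Matrix.add_apply]
  erw [h]
  simp

theorem jacobian_const (c : Vec κ) (x : Vec ι) : jacobian (fun _ => c) x = 0 := by
  ext k i
  simp [jacobian]

theorem SolvesODE.sub {z w F H : ℝ → ℝ} (hz : SolvesODE z F) (hw : SolvesODE w H) :
    SolvesODE (fun t => z t - w t) (fun t => F t - H t) := fun t ht => by
  obtain ⟨h1, h2⟩ := hz t ht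
  obtain ⟨h3, h4⟩ := hw t ht
  refine ⟨h1.sub h3, ?_⟩
  rw [intervalIntegral.integral_sub h1 h3]
  dsimp only
  rw [h2, h4]
  ring

theorem SolvesODE.congr {z F H : ℝ → ℝ} (hz : SolvesODE z F) (h : ∀ t, 0 ≤ t → F t = H t) :
    SolvesODE z H := fun t ht => by
  obtain ⟨h1, h2⟩ := hz t ht
  refine ⟨h1.congr fun s hs => h s ?_, ?_⟩
  · rw [uIoc_of_le ht] at hs
    exact hs.1.le
  · rw [h2]
    congr 1
    refine intervalIntegral.integral_congr fun s hs => h s ?_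
    rw [uIcc_of_le ht] at hs
    exact hs.1

end Linearization

/-! ### Linearization and error equation in observable form. -/

section ObservableSystems

open Matrix Set

variable {p m : ℕ} {l : Fin p → ℕ} {f : Components l m} {u : Vec (Fin m)} {L : ℝ}

theorem norm_lowerCoords_sub_le (j : ℕ) (x y : Vec (Idx l)) :
    ‖lowerCoords l j x - lowerCoords l j y‖ ≤ ‖x - y‖ := by
  refine le_of_sq_le_sq ?_ (norm_nonneg _)
  rw [EuclideanSpace.norm_sq_eq, EuclideanSpace.norm_sq_eq]
  simp only [lowerCoords, PiLp.sub_apply]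
  have h1 := Finset.sum_map Finset.univ (Function.Embedding.subtype fun r : Idx l => r.2.val ≤ j)
    (fun r => ‖x r - y r‖ ^ 2)
  refine h1.symm.trans_le ?_
  exact Finset.sum_le_sum_of_subset_of_nonneg (Finset.subset_univ _) fun _ _ _ => sq_nonneg _

theorem hasFDerivAt_fBar_component (hC2 : ContDiff ℝ 2 fun x => fBar l f x u) (s : Idx l)
    (x : Vec (Idx l)) :
    HasFDerivAt (fun z => f s (lowerCoords l s.2.val z) u)
      ((EuclideanSpace.proj s).comp (fderiv ℝ (fun z => fBar l f z u) x)) x :=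
  (EuclideanSpace.proj s : Vec (Idx l) →L[ℝ] ℝ).hasFDerivAt.comp x
    (hC2.differentiable (by norm_num) x).hasFDerivAt

theorem abs_jacobian_fBar_le (hC2 : ContDiff ℝ 2 fun x => fBar l f x u)
    (hLip : ∀ s : Idx l, ∀ z w : Vec (LowIdx l s.2.val), |f s z u - f s w u| ≤ L * ‖z - w‖)
    (x : Vec (Idx l)) (s r : Idx l) : |jacobian (fun z => fBar l f z u) x s r| ≤ |L| := by
  have h1 := hasFDerivAt_fBar_component hC2 s x
  have h2 : LipschitzWith (Real.nnabs L) fun z => f s (lowerCoords l s.2.val z) u := by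
    refine LipschitzWith.of_dist_le_mul fun z w => ?_
    rw [Real.dist_eq, dist_eq_norm, Real.coe_nnabs]
    refine (hLip s _ _).trans ?_
    exact mul_le_mul (le_abs_self L) (norm_lowerCoords_sub_le _ z w) (norm_nonneg _)
      (abs_nonneg L)
  have h3 := norm_fderiv_le_of_lipschitz ℝ (x₀ := x) h2
  rw [h1.fderiv] at h3
  have h4 := ContinuousLinearMap.le_of_opNorm_le _ h3 (EuclideanSpace.single r (1 : ℝ))
  simpa [jacobian] using h4

/-- Moving along the coordinate `r` leaves `x̲_j`, and so the component `s`, unchanged. This is the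
triangular pattern that the high-gain scaling needs. -/
theorem jacobian_fBar_eq_zero (hC2 : ContDiff ℝ 2 fun x => fBar l f x u) (x : Vec (Idx l))
    {s r : Idx l} (hsr : s.2.val < r.2.val) : jacobian (fun z => fBar l f z u) x s r = 0 := by
  have h1 := (hasFDerivAt_fBar_component hC2 s x).hasLineDerivAt (EuclideanSpace.single r (1 : ℝ))
  have h2 : (fun t : ℝ => f s (lowerCoords l s.2.val
      (x + t • EuclideanSpace.single r (1 : ℝ))) u)
      = fun _ => f s (lowerCoords l s.2.val x) u := by
    funext t
    congr 1
    ext q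
    have hq : q.1 ≠ r := fun h => by
      have := q.2
      rw [h] at this
      omega
    simp [lowerCoords, hq]
  rw [HasLineDerivAt, h2] at h1
  simpa [jacobian] using h1.unique (hasDerivAt_const _ _)

theorem jacobian_obsField (hC2 : ContDiff ℝ 2 fun x => fBar l f x u) (x : Vec (Idx l)) :
    jacobian (fun z => obsField l f z u) x = Abar l + jacobian (fun z => fBar l f z u) x :=
  jacobian_toLp_mulVec_add (hC2.differentiable (by norm_num) x)

theorem jacobian_obsOutput (h : Vec (Fin m) → Vec (Fin p)) (u : Vec (Fin m))
    (x : Vec (Idx l)) : jacobian (fun z => obsOutput l h z u) x = Cbar l := by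
  have := jacobian_toLp_mulVec_add (M := Cbar l) (differentiableAt_const (h u) (x := x))
  rwa [jacobian_const, add_zero] at this

/-- The second-order remainder of `f̄(·, u)` at `xhat`. -/
noncomputable def fBarRemainder (f : Components l m) (u : Vec (Fin m)) (x xhat : Vec (Idx l)) : Vec (Idx l) :=
  fBar l f x u - fBar l f xhat u - fderiv ℝ (fun z => fBar l f z u) xhat (x - xhat)

theorem norm_fBarRemainder_le (hC2 : ContDiff ℝ 2 fun x => fBar l f x u)
    (hHess : ∀ x ξ : Vec (Idx l),
      ‖iteratedFDeriv ℝ 2 (fun z => fBar l f z u) x ![ξ, ξ]‖ ≤ L * ‖ξ‖ ^ 2)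
    (x xhat : Vec (Idx l)) : ‖fBarRemainder f u x xhat‖ ≤ L * ‖x - xhat‖ ^ 2 := by
  simpa [fBarRemainder] using norm_sub_fderiv_le_of_norm_hessian_le hC2 hHess xhat (x - xhat)

/-- The error equation. Linearity of the output in the state makes the innovation exactly `C̄e`, so
the only remainder comes from `f̄`. -/
theorem obsField_sub_ekfEstimateRHS (hC2 : ContDiff ℝ 2 fun x => fBar l f x u)
    (h : Vec (Fin m) → Vec (Fin p)) (x xhat : Vec (Idx l)) (P : Matrix (Idx l) (Idx l) ℝ) :
    (obsField l f x u - ekfEstimateRHS (obsField l f) (obsOutput l h) u (obsOutput l h x u) xhat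
      P).ofLp
      = jacobian (fun z => obsField l f z u) xhat *ᵥ (x - xhat).ofLp
        - (P * (Cbar l)ᵀ) *ᵥ (Cbar l *ᵥ (x - xhat).ofLp) + (fBarRemainder f u x xhat).ofLp := by
  rw [jacobian_obsField hC2, add_mulVec, jacobian_mulVec, ekfEstimateRHS, jacobian_obsOutput]
  have h1 : (obsOutput l h x u - obsOutput l h xhat u).ofLp = Cbar l *ᵥ (x - xhat).ofLp := by
    simp [obsOutput, mulVec_sub]
  rw [h1]
  simp only [obsField, fBarRemainder, WithLp.ofLp_sub, WithLp.ofLp_add, mulVec_sub]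
  abel

end ObservableSystems

/-! ### The main theorem. -/

theorem theorem1 {p m : ℕ} (l : Fin p → ℕ) (hl : ∀ i, 1 ≤ l i) (hmono : Monotone l)
    (U : Set (Vec (Fin m))) (f : Components l m) (h : Vec (Fin m) → Vec (Fin p)) (L : ℝ)
    (hC2 : ∀ u ∈ U, ContDiff ℝ 2 (fun x => fBar l f x u))
    (hLip : ∀ s : Idx l, ∀ u ∈ U, ∀ z w : Vec (LowIdx l s.2.val),
      |f s z u - f s w u| ≤ L * ‖z - w‖)
    (hHess : ∀ u ∈ U, ∀ x ξ : Vec (Idx l),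
      ‖iteratedFDeriv ℝ 2 (fun z => fBar l f z u) x ![ξ, ξ]‖ ≤ L * ‖ξ‖ ^ 2)
    (G : Matrix (Idx l) (Idx l) ℝ) (hG : IsUnit G)
    (P0 : Matrix (Idx l) (Idx l) ℝ) (hP0 : P0.PosDef) :
    ∃ δ > 0, ∃ K > 0, ∃ α > 0,
      ∀ (u : ℝ → Vec (Fin m)) (x : ℝ → Vec (Idx l)) (y : ℝ → Vec (Fin p))
        (xhat : ℝ → Vec (Idx l)) (P : ℝ → Matrix (Idx l) (Idx l) ℝ),
        (∀ t, 0 ≤ t → u t ∈ U) →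
        IsTrajectory (obsField l f) (obsOutput l h) u x y →
        IsEKF (obsField l f) (obsOutput l h) G u y xhat P →
        P 0 = P0 →
        ‖x 0 - xhat 0‖ < δ →
        ∀ t, 0 ≤ t → ‖x t - xhat t‖ ≤ K * Real.exp (-(α * t)) * ‖x 0 - xhat 0‖ := by
  -- `|L|` in place of `L`, whose sign is not assumed.
  obtain ⟨S, hS, b, hb, hgain⟩ := exists_highGain l |L|
  obtain ⟨K, hK, hbounds⟩ := exists_riccati_bounds hS hb (Cbar l) hG hP0 (1 + |L|)
  obtain ⟨δ, hδ, α, hα, hdecay⟩ := exists_exp_decay hG (Cbar l) hK (abs_nonneg L)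
  -- The decay estimate is for the squared error, with constant `K²` and rate `α`; its square root
  -- has constant `K` and rate `α / 2`.
  refine ⟨δ, hδ, K, hK, α / 2, by positivity, fun u x y xhat P hu htraj hekf hP0' h0 t ht => ?_⟩
  let A : ℝ → Matrix (Idx l) (Idx l) ℝ := fun t =>
    jacobian (fun z => obsField l f z (u t)) (xhat t)
  have hA : ∀ t, 0 ≤ t → A t = Abar l + jacobian (fun z => fBar l f z (u t)) (xhat t) :=
    fun t ht => jacobian_obsField (hC2 _ (hu t ht)) _
  have hJ : ∀ t, 0 ≤ t → ∀ s r, |jacobian (fun z => fBar l f z (u t)) (xhat t) s r| ≤ |L| :=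
    fun t ht => abs_jacobian_fBar_le (hC2 _ (hu t ht)) (fun s => hLip s _ (hu t ht)) _
  have hric : SolvesRiccati A (Cbar l) G P := fun i j => by
    have := hekf.riccati i j
    simp only [ekfRiccatiRHS, jacobian_obsOutput] at this
    exact this
  have hPm := hbounds A P hric hP0'
    (fun t ht s r => by
      rw [hA t ht, Matrix.add_apply]
      refine (abs_add_le _ _).trans (add_le_add ?_ (hJ t ht s r))
      simp only [Abar, Matrix.of_apply]
      split_ifs <;> simp)
    (fun t ht v => by
      rw [hA t ht]
      exact hgain _ (hJ t ht) (fun s r => jacobian_fBar_eq_zero (hC2 _ (hu t ht)) _) v)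
  have hmain := hdecay A P (fun t => (x t - xhat t).ofLp)
    (fun t => (fBarRemainder f (u t) (x t) (xhat t)).ofLp) hric hPm
    (fun i => ((htraj.state i).sub (hekf.estimate i)).congr fun t ht => by
      rw [htraj.output t ht]
      exact congrFun (obsField_sub_ekfEstimateRHS (hC2 _ (hu t ht)) h (x t) (xhat t) (P t)) i)
    (fun t ht => by
      rw [← norm_sq_eq_dotProduct, ← norm_sq_eq_dotProduct]
      refine pow_le_pow_left₀ (norm_nonneg _) ?_ 2
      refine (norm_fBarRemainder_le (hC2 _ (hu t ht)) (hHess _ (hu t ht)) _ _).trans ?_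
      exact mul_le_mul_of_nonneg_right (le_abs_self L) (sq_nonneg _))
    (by
      rw [← norm_sq_eq_dotProduct]
      exact pow_lt_pow_left₀ h0 (norm_nonneg _) two_ne_zero) t ht
  rw [← norm_sq_eq_dotProduct, ← norm_sq_eq_dotProduct] at hmain
  refine le_of_sq_le_sq (hmain.trans (le_of_eq ?_)) (by positivity)
  rw [mul_pow, mul_pow, ← Real.exp_nat_mul]
  congr 3
  push_cast
  ring
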